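/- **Setting.** There are $N\ge 1$ real nodes and finitely many (possibly zero) virtual nodes; virtual nodes only relay delayed messages and have objective $0$. Real node $n$ has a sample law $\mathcal D_n$ and a stochastic cost $F_n(x,\xi_n)$, $x\in\mathbb R^d$; put $f_n(x)=\mathbb E_{\xi_n\sim\mathcal D_n}F_n(x,\xi_n)$ (assumed to exist) and $f=\frac1N\sum_{n=1}^N f_n$. In round $k=0,1,\dots$ the nodes use a (possibly random) real weight matrix $W^{[k]}$, indexed by all nodes, and fresh samples $\xi_n^{[k]}\sim\mathcal D_n$. The samples are independent over nodes and rounds, the matrices $W^{[k]}$ are independent over rounds, and the samples are independent of the matrices. **Algorithm (DT-GO, minimization phase, with exact correction weights).** All nodes start at the same point $x^{[0]}$. In round $k$ each real node forms $y=x_n^{[k]}-\eta\nabla F_n(x_n^{[k]},\xi_n^{[k]})$ and $z_n=x_n^{[k]}+\frac1{N\pi_n}(y-x_n^{[k]})$, each virtual node puts $z_n=x_n^{[k]}$, and then $x_n^{[k+1]}=\sum_m W^{[k]}_{nm}z_m$ for every node. Let $\tilde x^{[k]}=\sum_n\pi_n x_n^{[k]}$, summed over all nodes. **Assumption on the weights.**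 Products are time-ordered (later rounds on the left), $\|\cdot\|_2$ is the spectral norm, $D$ is diagonal with entries $\frac1{N\pi_n}$ at real nodes and $1$ at virtual nodes, and $J$ has all entries $1/N$. 1. $W^\infty=\lim_{k}\mathbb E[W^{[k]}\cdots W^{[0]}]$ exists, and $W^{[k]}W^\infty=W^\infty=W^\infty W^{[k]}$ almost surely for all $k$. 2. All rows of $W^\infty$ equal $\pi$, with $\pi_n\ge0$, $\sum_n\pi_n=1$, and $\pi_n>0$ for real nodes. 3. There are $0<p\le1$ and an integer $\tau\ge1$ with $\mathbb E\|W^\infty-W^{[k-1]}\cdots W^{[k-\tau]}\|_2^2\le1-p$ for all $k\ge\tau$. 4. There is $\beta>0$ with $\mathbb E\|W^{[k-1]}\cdots W^{[\ell]}D-J\|_2^2\le\beta^2$ for all $k\ge 1$ and all $\ell$ with $\max(0,k-\tau)\le\ell<k$. The bound $\beta$ is taken large enough that $\beta\tau\ge p$ (for example $\beta\ge1$). **Assumption on the costs.** Each $F_n(\cdot,\xi)$ is convex (so $f$ is convex), continuously differentiable, and has an $L$-Lipschitz gradient; $f$ has a global minimizer $x^\star$, with $f^\star=f(x^\star)$;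 and $\bar\zeta^2=\frac1N\sum_n\|\nabla f_n(x^\star)\|_2^2$ and $\bar\sigma^2=\frac1N\sum_n\mathbb E\|\nabla F_n(x^\star,\xi_n)-\nabla f_n(x^\star)\|_2^2$ are finite. **Theorem.** There is an absolute constant $C>0$ such that in every such setting and for every $\epsilon>0$ there is a constant step size $\eta>0$ for which all expectations $\mathbb E f(\tilde x^{[k]})$ exist and $$\frac1K\sum_{k=0}^{K-1}\mathbb E f(\tilde x^{[k]})-f^\star\le\epsilon$$ for every integer $K\ge1$ with $$K\ \ge\ C\left(\frac{\bar\sigma^2}{N\epsilon^2}+\frac{\beta\sqrt L\,(\bar\zeta\tau+\bar\sigma\sqrt{p\tau})}{p\,\epsilon^{3/2}}+\frac{\beta L\tau}{p\,\epsilon}\right)\|\tilde x^{[0]}-x^\star\|_2^2 .$$ -/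

import Mathlib

open MeasureTheory ProbabilityTheory Filter Topology

noncomputable section

namespace DTGO

/-! ### Cost functions

`ι` is the finite set of real (computing) nodes, `κ` the finite, possibly empty, set of virtual
nodes that relay delayed messages. `F n x z` is the cost of node `n` at the model `x` and the
sample `z`, and `𝒟 n` is the law of the samples of node `n`. -/

section Costs

variable {ι Ξ : Type*} [MeasurableSpace Ξ] {d : ℕ}

/-- `L`-smoothness: continuously differentiable with an `L`-Lipschitz gradient. -/
def LSmooth (L : ℝ) (g : EuclideanSpace ℝ (Fin d) → ℝ) : Prop :=
  ContDiff ℝ 1 g ∧ ∀ x y, ‖gradient g x - gradient g y‖ ≤ L * ‖x - y‖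

/-- The local objective `f_n(x) = E_{z ∼ 𝒟_n} F_n(x, z)`. -/
def localCost (𝒟 : ι → Measure Ξ) (F : ι → EuclideanSpace ℝ (Fin d) → Ξ → ℝ) (n : ι)
    (x : EuclideanSpace ℝ (Fin d)) : ℝ :=
  ∫ z, F n x z ∂(𝒟 n)

/-- The stochastic gradient `∇ F_n(x, z)`, the gradient being taken in `x`. -/
def stochGrad (F : ι → EuclideanSpace ℝ (Fin d) → Ξ → ℝ) (n : ι)
    (x : EuclideanSpace ℝ (Fin d)) (z : Ξ) : EuclideanSpace ℝ (Fin d) :=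
  gradient (fun y => F n y z) x

/-- The noise level `σ_n² = E ‖∇F_n(x⋆, z) - ∇f_n(x⋆)‖²` at the point `xs = x⋆`. -/
def noiseSq (𝒟 : ι → Measure Ξ) (F : ι → EuclideanSpace ℝ (Fin d) → Ξ → ℝ)
    (xs : EuclideanSpace ℝ (Fin d)) (n : ι) : ℝ :=
  ∫ z, ‖stochGrad F n xs z - gradient (localCost 𝒟 F n) xs‖ ^ 2 ∂(𝒟 n)

variable [Fintype ι]

/-- The global objective `f = (1/N) ∑ f_n`, where `N` is the number of real nodes. -/
def globalCost (𝒟 : ι → Measure Ξ) (F : ι → EuclideanSpace ℝ (Fin d) → Ξ → ℝ)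
    (x : EuclideanSpace ℝ (Fin d)) : ℝ :=
  (1 / (Fintype.card ι : ℝ)) * ∑ n, localCost 𝒟 F n x

/-- `σ̄`, with `σ̄² = (1/N) ∑ σ_n²`. -/
def noiseLevel (𝒟 : ι → Measure Ξ) (F : ι → EuclideanSpace ℝ (Fin d) → Ξ → ℝ)
    (xs : EuclideanSpace ℝ (Fin d)) : ℝ :=
  √((1 / (Fintype.card ι : ℝ)) * ∑ n, noiseSq 𝒟 F xs n)

/-- `ζ̄`, with `ζ̄² = (1/N) ∑ ‖∇f_n(x⋆)‖²`. -/
def heterogeneity (𝒟 : ι → Measure Ξ) (F : ι → EuclideanSpace ℝ (Fin d) → Ξ → ℝ)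
    (xs : EuclideanSpace ℝ (Fin d)) : ℝ :=
  √((1 / (Fintype.card ι : ℝ)) * ∑ n, ‖gradient (localCost 𝒟 F n) xs‖ ^ 2)

/-- The assumptions on the costs: the stochastic costs are convex and `L`-smooth in the model,
the local objectives are well defined, `xs` is a global minimizer of the global objective, and
the noise at `xs` is finite. -/
structure ConvexCosts (𝒟 : ι → Measure Ξ) (F : ι → EuclideanSpace ℝ (Fin d) → Ξ → ℝ)
    (L : ℝ) (xs : EuclideanSpace ℝ (Fin d)) : Prop where
  measurable : ∀ n x, Measurable (F n x)
  integrable : ∀ n x, Integrable (F n x) (𝒟 n)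
  convex : ∀ n z, ConvexOn ℝ Set.univ (fun x => F n x z)
  smooth : ∀ n z, LSmooth L (fun x => F n x z)
  minimizer : ∀ x, globalCost 𝒟 F xs ≤ globalCost 𝒟 F x
  finite_noise : ∀ n,
    Integrable (fun z => ‖stochGrad F n xs z - gradient (localCost 𝒟 F n) xs‖ ^ 2) (𝒟 n)

end Costs

/-! ### Weight matrices -/

section Gossip

variable {ι κ Ω : Type*} [Fintype ι] [DecidableEq ι] [Fintype κ] [DecidableEq κ]

/-- The spectral norm (operator 2-norm) of a square matrix. -/
def specNorm {V : Type*} [Fintype V] [DecidableEq V] (A : Matrix V V ℝ) : ℝ :=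
  ‖Matrix.toEuclideanCLM (n := V) (𝕜 := ℝ) A‖

/-- The time-ordered product `W^[s+r-1] ⋯ W^[s+1] W^[s]` over the `r` rounds that start with
round `s`: the matrix that maps the states of round `s` to those of round `s + r` when only
gossip steps are made. -/
def gossipProd {V : Type*} [Fintype V] [DecidableEq V] (W : ℕ → Ω → Matrix V V ℝ)
    (s : ℕ) : ℕ → Ω → Matrix V V ℝ
  | 0, _ => 1
  | r + 1, ω => W (s + r) ω * gossipProd W s r ω

/-- `W^∞`: every row is `π`. -/
def limitMatrix {V : Type*} (π : V → ℝ) : Matrix V V ℝ :=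
  Matrix.of fun _ j => π j

/-- The entries of the correction matrix: `1 / (N π_n)` at real nodes, `1` at virtual ones. -/
def correction (π : ι ⊕ κ → ℝ) : ι ⊕ κ → ℝ
  | .inl n => 1 / ((Fintype.card ι : ℝ) * π (.inl n))
  | .inr _ => 1

/-- `J`: all entries are `1 / N`, with `N` the number of real nodes. -/
def averageMatrix (ι κ : Type*) [Fintype ι] : Matrix (ι ⊕ κ) (ι ⊕ κ) ℝ :=
  Matrix.of fun _ _ => 1 / (Fintype.card ι : ℝ)

/-- The assumptions on the (random) weight matrices, with parameters `p`, `τ` and `β`.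
The communication graph of a round is the support of the weight matrix of that round, so it
does not appear separately. -/
structure GossipAssumption [MeasurableSpace Ω] (μ : Measure Ω)
    (W : ℕ → Ω → Matrix (ι ⊕ κ) (ι ⊕ κ) ℝ) (π : ι ⊕ κ → ℝ) (p : ℝ) (τ : ℕ) (β : ℝ) :
    Prop where
  /-- The expected products exist and converge to `W^∞`. -/
  integrable_prod : ∀ k i j, Integrable (fun ω => gossipProd W 0 (k + 1) ω i j) μ
  tendsto_prod : ∀ i j, Tendsto (fun k => ∫ ω, gossipProd W 0 (k + 1) ω i j ∂μ) atTop
    (𝓝 (limitMatrix π i j))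
  mul_limit : ∀ k, ∀ᵐ ω ∂μ, W k ω * limitMatrix π = limitMatrix π
  limit_mul : ∀ k, ∀ᵐ ω ∂μ, limitMatrix π * W k ω = limitMatrix π
  /-- The rows of `W^∞` are stochastic, and positive at the real nodes. -/
  nonneg : ∀ i, 0 ≤ π i
  sum_eq_one : ∑ i, π i = 1
  pos_real : ∀ n : ι, 0 < π (.inl n)
  /-- Contraction in mean square over any `τ` consecutive rounds. -/
  p_pos : 0 < p
  p_le_one : p ≤ 1
  one_le_tau : 1 ≤ τ
  contraction : ∀ s,
    Integrable (fun ω => specNorm (limitMatrix π - gossipProd W s τ ω) ^ 2) μ ∧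
      ∫ ω, specNorm (limitMatrix π - gossipProd W s τ ω) ^ 2 ∂μ ≤ 1 - p
  /-- Boundedness of the corrected products over at most `τ` consecutive rounds. -/
  beta_pos : 0 < β
  bounded : ∀ s r, 1 ≤ r → r ≤ τ →
    Integrable (fun ω => specNorm
        (gossipProd W s r ω * Matrix.diagonal (correction π) - averageMatrix ι κ) ^ 2) μ ∧
      ∫ ω, specNorm
        (gossipProd W s r ω * Matrix.diagonal (correction π) - averageMatrix ι κ) ^ 2 ∂μ
        ≤ β ^ 2

/-- The randomness: `ξ k n` is the sample drawn by node `n` in round `k`, with law `𝒟 n`. The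
samples are independent over nodes and rounds, the weight matrices are independent over
rounds, and the samples are independent of the weight matrices. -/
structure RandomModel {Ξ : Type*} [MeasurableSpace Ω] [MeasurableSpace Ξ] (μ : Measure Ω)
    (W : ℕ → Ω → Matrix (ι ⊕ κ) (ι ⊕ κ) ℝ) (𝒟 : ι → Measure Ξ) (ξ : ℕ → ι → Ω → Ξ) :
    Prop where
  measurable_weight : ∀ k i j, Measurable fun ω => W k ω i j
  measurable_sample : ∀ k n, Measurable (ξ k n)
  law : ∀ k n, μ.map (ξ k n) = 𝒟 n
  indep_weight : iIndepFun (fun k ω (i j : ι ⊕ κ) => W k ω i j) μ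
  indep_sample : iIndepFun (fun (i : ℕ × ι) => ξ i.1 i.2) μ
  indep : IndepFun (fun ω k (i j : ι ⊕ κ) => W k ω i j) (fun ω (i : ℕ × ι) => ξ i.1 i.2 ω) μ

end Gossip

/-! ### The algorithm -/

section Algorithm

variable {ι κ Ω Ξ : Type*} [Fintype ι] [Fintype κ] {d : ℕ}

/-- The state `z` that a node broadcasts in a round: a real node `n` makes the stochastic
gradient step `y = x_n - η ∇F_n(x_n, ξ_n)` and adjusts it to
`z_n = x_n + (1 / (N π_n)) (y - x_n)`; a virtual node (zero objective) relays its state. -/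
def localStep (F : ι → EuclideanSpace ℝ (Fin d) → Ξ → ℝ) (π : ι ⊕ κ → ℝ) (η : ℝ)
    (x : ι ⊕ κ → EuclideanSpace ℝ (Fin d)) (z : ι → Ξ) :
    ι ⊕ κ → EuclideanSpace ℝ (Fin d)
  | .inl n => x (.inl n) + (1 / ((Fintype.card ι : ℝ) * π (.inl n))) •
      ((x (.inl n) - η • stochGrad F n (x (.inl n)) (z n)) - x (.inl n))
  | .inr v => x (.inr v)

/-- The iterates `x_n^[k]` of DT-GO (its minimization phase, with the exact correction weights)
with constant step size `η`, all nodes being started at `x₀`. -/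
def iterate (W : ℕ → Ω → Matrix (ι ⊕ κ) (ι ⊕ κ) ℝ)
    (F : ι → EuclideanSpace ℝ (Fin d) → Ξ → ℝ) (π : ι ⊕ κ → ℝ) (ξ : ℕ → ι → Ω → Ξ)
    (η : ℝ) (x₀ : EuclideanSpace ℝ (Fin d)) :
    ℕ → Ω → ι ⊕ κ → EuclideanSpace ℝ (Fin d)
  | 0, _ => fun _ => x₀
  | k + 1, ω => fun i =>
      ∑ j, W k ω i j • localStep F π η (iterate W F π ξ η x₀ k ω) (fun n => ξ k n ω) j

/-- The weighted average `x̃ = ∑ π_i x_i` of the states. -/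
def weightedAverage (π : ι ⊕ κ → ℝ) (x : ι ⊕ κ → EuclideanSpace ℝ (Fin d)) :
    EuclideanSpace ℝ (Fin d) :=
  ∑ i, π i • x i

end Algorithm

/-- The order of the number of iterations, up to the factor `‖x̃^[0] - x⋆‖²`. -/
def iterationOrder (N : ℕ) (L β p : ℝ) (τ : ℕ) (σ ζ ε : ℝ) : ℝ :=
  σ ^ 2 / (N * ε ^ 2) + β * √L * (ζ * τ + σ * √(p * τ)) / (p * ε ^ (3 / 2 : ℝ))
    + β * L * τ / (p * ε)

end DTGO

end

/-! Two quantities govern the algorithm: the weighted average `avg` and the deviations `dev` of all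
states from it. Since `W^∞ W = W^∞` and the correction `1/(N π_n)` cancels the weight `π_n`, the
average makes an exact stochastic gradient step with uniform weights, only with gradients taken at
the local states. Convexity and smoothness turn this into a descent inequality
(`Setting.integral_avg_sq_succ`): the squared distance to `x⋆` drops by about `2η` times the
optimality gap, up to `ηL/N` times the squared deviations and `(η/N)²` times the squared noise.
Noises of different nodes are orthogonal, whence the variance term `σ²/N`.

Over a block of at most `τ` rounds the deviations are a contracted copy of the old ones minus `η`
times the gradients, propagated by the matrices `W ⋯ W D - J` (`FixesLimit.dev_add`). The gradients
split into means and noise. The means cost a factor `τ` by Cauchy-Schwarz and `1/p` by Young's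
inequality. The noise is orthogonal to the old deviations and across rounds, so it costs neither
(`Setting.integral_dev_sq_block`). Summing over rounds adds a factor `2τ/p`, so heterogeneity enters
through `(ζτ/p)²` and noise only through `σ²τ/p = (σ√(pτ)/p)²`: hence the middle term of the bound.

Squared means and noise are in turn bounded by deviations, gaps and their values at `x⋆`, through
cocoercivity with the average as reference point. If `η β L τ / p ≤ 1/40`, this feedback is absorbed
(`gap_le_of_summed_estimates`). With `A` the order of the iteration count, the choice `η = 1/(40 ε
A)` (for `A > 0`) makes every remaining error a small fraction of `ε`. -/

noncomputable section

set_option linter.unusedSectionVars false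

namespace DTGO

/-! ### Smooth convex functions -/

section Convex

variable {E : Type*} [NormedAddCommGroup E] [InnerProductSpace ℝ E]

/-- `g` lies above its linear approximations (with slopes `g'`) and below its quadratic
approximations of curvature `L`. -/
structure SmoothConvex (L : ℝ) (g : E → ℝ) (g' : E → E) : Prop where
  lower : ∀ x y, g x + inner ℝ (g' x) (y - x) ≤ g y
  upper : ∀ x y, g y ≤ g x + inner ℝ (g' x) (y - x) + L / 2 * ‖y - x‖ ^ 2

/-- The Bregman divergence `g x - g y - ⟪g' y, x - y⟫`. -/
def bregman (g : E → ℝ) (g' : E → E) (x y : E) : ℝ :=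
  g x - g y - inner ℝ (g' y) (x - y)

namespace SmoothConvex

variable {L : ℝ} {g : E → ℝ} {g' : E → E}

theorem bregman_nonneg (h : SmoothConvex L g g') (x y : E) : 0 ≤ bregman g g' x y := by
  have := h.lower y x
  unfold bregman; linarith

theorem bregman_le (h : SmoothConvex L g g') (x y : E) :
    bregman g g' x y ≤ L / 2 * ‖x - y‖ ^ 2 := by
  have := h.upper y x
  unfold bregman; linarith

/-- Compare the tangent at `y` with the quadratic at `x`, both evaluated at `x - t (g' x - g' y)`;
the best `t` is `1/L`. -/
theorem cocoercive (hL : 0 ≤ L) (h : SmoothConvex L g g') (x y : E) :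
    ‖g' x - g' y‖ ^ 2 ≤ 2 * L * bregman g g' x y := by
  have key : ∀ t : ℝ, t * ‖g' x - g' y‖ ^ 2 - L / 2 * t ^ 2 * ‖g' x - g' y‖ ^ 2
      ≤ bregman g g' x y := by
    intro t
    have h1 := h.lower y (x - t • (g' x - g' y))
    have h2 := h.upper x (x - t • (g' x - g' y))
    have e1 : x - t • (g' x - g' y) - x = -(t • (g' x - g' y)) := by abel
    have e2 : x - t • (g' x - g' y) - y = (x - y) - t • (g' x - g' y) := by abel
    rw [e1, norm_neg, norm_smul, mul_pow, Real.norm_eq_abs, sq_abs, inner_neg_right,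
      inner_smul_right] at h2
    rw [e2, inner_sub_right, inner_smul_right] at h1
    have h3 : inner ℝ (g' x) (g' x - g' y) - inner ℝ (g' y) (g' x - g' y)
        = ‖g' x - g' y‖ ^ 2 := by
      rw [← inner_sub_left, real_inner_self_eq_norm_sq]
    unfold bregman
    rw [← h3] at h2 ⊢
    nlinarith
  have hB := h.bregman_nonneg x y
  rcases hL.eq_or_lt with rfl | hL
  -- For `L = 0` the bound is linear in `t`; this `t` would give `2(B + 1) ≤ B` with `B ≥ 0`, so the
  -- slopes agree.
  · have h2 := key (2 * (bregman g g' x y + 1) / (‖g' x - g' y‖ ^ 2))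
    by_cases h0 : ‖g' x - g' y‖ ^ 2 = 0
    · rw [h0]; simp
    · rw [div_mul_cancel₀ _ h0] at h2
      simp at h2
      linarith
  · have h1 := key (1 / L)
    have : 1 / L * ‖g' x - g' y‖ ^ 2 - L / 2 * (1 / L) ^ 2 * ‖g' x - g' y‖ ^ 2
        = ‖g' x - g' y‖ ^ 2 / (2 * L) := by field_simp; ring
    rw [this, div_le_iff₀ (by positivity)] at h1
    linarith

theorem lipschitz (hL : 0 ≤ L) (h : SmoothConvex L g g') (x y : E) :
    ‖g' x - g' y‖ ≤ L * ‖x - y‖ := by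
  have h1 := h.cocoercive hL x y
  have h2 := h.bregman_le x y
  have h3 : ‖g' x - g' y‖ ^ 2 ≤ (L * ‖x - y‖) ^ 2 := by
    nlinarith [mul_le_mul_of_nonneg_left h2 hL]
  exact (abs_le_of_sq_le_sq' h3 (by positivity)).2

/-- The sandwich between tangent and quadratic already forces differentiability. As the sandwich
survives integration, the local objectives get their gradients without differentiating under the
integral. -/
theorem hasGradientAt [CompleteSpace E] (h : SmoothConvex L g g') (x : E) :
    HasGradientAt g (g' x) x := by
  rw [hasGradientAt_iff_isLittleO]
  refine Asymptotics.IsBigO.trans_isLittleO (g := fun y => ‖y - x‖ ^ 2) ?_ ?_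
  · refine Asymptotics.IsBigO.of_bound (|L / 2|) (Filter.Eventually.of_forall fun y => ?_)
    have h1 := h.lower x y
    have h2 := h.upper x y
    rw [Real.norm_eq_abs, abs_of_nonneg (by linarith), norm_pow, norm_norm]
    have := le_abs_self (L / 2)
    nlinarith [sq_nonneg ‖y - x‖]
  · refine Asymptotics.isLittleO_of_tendsto (f := fun y => ‖y - x‖ ^ 2)
      (g := fun y => ‖y - x‖) (l := 𝓝 x) ?_ ?_ |>.of_norm_right
    · intro y hy; simp [hy]
    · have : (fun y => ‖y - x‖ ^ 2 / ‖y - x‖) = fun y => ‖y - x‖ := by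
        ext y
        by_cases hy : ‖y - x‖ = 0
        · simp [hy]
        · field_simp
      rw [this]
      have : ContinuousAt (fun y => ‖y - x‖) x := by fun_prop
      simpa [ContinuousAt] using this

theorem grad_eq_zero (hL : 0 ≤ L) (h : SmoothConvex L g g') {x : E} (hx : ∀ y, g x ≤ g y) :
    g' x = 0 := by
  -- The step length `1/(L + 1)` rather than `1/L` covers `L = 0` as well.
  have h1 := h.upper x (x - (1 / (L + 1)) • g' x)
  have e1 : x - (1 / (L + 1)) • g' x - x = -((1 / (L + 1)) • g' x) := by abel
  rw [e1, norm_neg, norm_smul, mul_pow, Real.norm_eq_abs, sq_abs, inner_neg_right,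
      inner_smul_right, real_inner_self_eq_norm_sq] at h1
  have h2 := hx (x - (1 / (L + 1)) • g' x)
  have h3 : -(1 / (L + 1) * ‖g' x‖ ^ 2) + L / 2 * ((1 / (L + 1)) ^ 2 * ‖g' x‖ ^ 2)
      = -((L + 2) / (2 * (L + 1) ^ 2) * ‖g' x‖ ^ 2) := by field_simp; ring
  have h4 : (L + 2) / (2 * (L + 1) ^ 2) * ‖g' x‖ ^ 2 ≤ 0 := by linarith
  have h5 : 0 < (L + 2) / (2 * (L + 1) ^ 2) := by positivity
  have h6 : ‖g' x‖ ^ 2 ≤ 0 := by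
    by_contra hc
    push Not at hc
    nlinarith [mul_pos h5 hc]
  have : ‖g' x‖ = 0 := by nlinarith [norm_nonneg (g' x)]
  simpa using this

/-- A gradient step bound: the slope at `x` tested against `y - s`. -/
theorem inner_ge (h : SmoothConvex L g g') (x y s : E) :
    g y - g s - L / 2 * ‖x - y‖ ^ 2 ≤ inner ℝ (g' x) (y - s) := by
  have h1 := h.lower x s
  have h2 := h.upper x y
  have e : y - s = (y - x) - (s - x) := by abel
  rw [e, inner_sub_right, norm_sub_rev x y]
  linarith

theorem continuous [CompleteSpace E] (h : SmoothConvex L g g') : Continuous g :=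
  continuous_iff_continuousAt.2 fun x => (h.hasGradientAt x).hasFDerivAt.continuousAt

theorem continuous_grad (hL : 0 ≤ L) (h : SmoothConvex L g g') : Continuous g' :=
  (LipschitzWith.of_dist_le_mul (K := L.toNNReal) fun x y => by
    simpa [dist_eq_norm, Real.coe_toNNReal L hL] using h.lipschitz hL x y).continuous

end SmoothConvex

theorem LSmooth.differentiable {d : ℕ} {L : ℝ} {g : EuclideanSpace ℝ (Fin d) → ℝ}
    (h : LSmooth L g) : Differentiable ℝ g := h.1.differentiable (by simp)

/-- The descent lemma together with the first order characterization of convexity. -/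
theorem SmoothConvex.of_lSmooth {d : ℕ} {L : ℝ} {g : EuclideanSpace ℝ (Fin d) → ℝ}
    (hc : ConvexOn ℝ Set.univ g) (h : LSmooth L g) : SmoothConvex L g (gradient g) := by
  have hline : ∀ (x y : EuclideanSpace ℝ (Fin d)) (t : ℝ),
      HasDerivAt (fun t : ℝ => g (x + t • (y - x)))
        (inner ℝ (gradient g (x + t • (y - x))) (y - x)) t := by
    intro x y t
    have h1 := (h.differentiable (x + t • (y - x))).hasGradientAt.hasFDerivAt
    have h2 : HasDerivAt (fun t : ℝ => x + t • (y - x)) (y - x) t := by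
      simpa using ((hasDerivAt_id t).smul_const (y - x)).const_add x
    exact h1.comp_hasDerivAt t h2
  constructor
  · intro x y
    have hconv : ConvexOn ℝ Set.univ (fun t : ℝ => g (x + t • (y - x))) := by
      have := hc.comp_affineMap (AffineMap.lineMap x y : ℝ →ᵃ[ℝ] EuclideanSpace ℝ (Fin d))
      rw [Set.preimage_univ] at this
      refine this.congr fun t _ => ?_
      simp [AffineMap.lineMap_apply, add_comm]
    have h0 := hline x y 0
    have := hconv.le_slope_of_hasDerivAt (Set.mem_univ 0) (Set.mem_univ 1) zero_lt_one h0
    simp only [slope_def_field, zero_smul, add_zero, one_smul, add_sub_cancel, sub_zero,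
      div_one] at this
    linarith
  · intro x y
    -- The Lipschitz bound makes the derivative of `φ` nonpositive on `[0, 1]`; `φ 1 ≤ φ 0` is the
    -- quadratic upper bound.
    let φ : ℝ → ℝ := fun t => g (x + t • (y - x)) - t * inner ℝ (gradient g x) (y - x)
      - L / 2 * t ^ 2 * ‖y - x‖ ^ 2
    have hφ : ∀ t, HasDerivAt φ (inner ℝ (gradient g (x + t • (y - x))) (y - x)
        - inner ℝ (gradient g x) (y - x) - L * t * ‖y - x‖ ^ 2) t := by
      intro t
      have h1 := ((hline x y t).sub ((hasDerivAt_id t).mul_const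
        (inner ℝ (gradient g x) (y - x)))).sub
        ((((hasDerivAt_id t).pow 2).const_mul (L / 2)).mul_const (‖y - x‖ ^ 2))
      refine (h1.congr_deriv ?_)
      simp only [id, Nat.cast_ofNat]
      ring
    have hanti : AntitoneOn φ (Set.Icc 0 1) := by
      refine antitoneOn_of_deriv_nonpos (convex_Icc 0 1)
        (fun t _ => (hφ t).continuousAt.continuousWithinAt)
        (fun t _ => (hφ t).differentiableAt.differentiableWithinAt) ?_
      intro t ht
      rw [interior_Icc] at ht
      rw [(hφ t).deriv, ← inner_sub_left]
      have h1 := real_inner_le_norm (gradient g (x + t • (y - x)) - gradient g x) (y - x)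
      have h2 := h.2 (x + t • (y - x)) x
      rw [add_sub_cancel_left, norm_smul, Real.norm_eq_abs, abs_of_pos ht.1] at h2
      nlinarith [mul_le_mul_of_nonneg_right h2 (norm_nonneg (y - x))]
    have := hanti (Set.left_mem_Icc.2 zero_le_one) (Set.right_mem_Icc.2 zero_le_one) zero_le_one
    simp only [φ, zero_smul, add_zero, one_smul, add_sub_cancel] at this
    linarith

end Convex

/-! ### Second moments of random vectors -/

theorem norm_add₃_sq_le {E : Type*} [SeminormedAddCommGroup E] (a b c : E) :
    ‖a + b + c‖ ^ 2 ≤ 3 * ‖a‖ ^ 2 + 3 * ‖b‖ ^ 2 + 3 * ‖c‖ ^ 2 := by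
  have h := norm_add₃_le (a := a) (b := b) (c := c)
  have h0 := norm_nonneg (a + b + c)
  nlinarith [sq_nonneg (‖a‖ - ‖b‖), sq_nonneg (‖b‖ - ‖c‖), sq_nonneg (‖a‖ - ‖c‖),
    mul_self_le_mul_self h0 h]

section SecondMoment

variable {Ω E : Type*} [MeasurableSpace Ω] {μ : Measure Ω} [NormedAddCommGroup E]

theorem integral_add₃ {f g h : Ω → ℝ} (hf : Integrable f μ) (hg : Integrable g μ)
    (hh : Integrable h μ) :
    ∫ ω, f ω + g ω + h ω ∂μ = ∫ ω, f ω ∂μ + ∫ ω, g ω ∂μ + ∫ ω, h ω ∂μ := by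
  have : Integrable (fun ω => f ω + g ω) μ := hf.add hg
  rw [integral_add this hh, integral_add hf hg]

theorem integral_sub₃ {f g h : Ω → ℝ} (hf : Integrable f μ) (hg : Integrable g μ)
    (hh : Integrable h μ) :
    ∫ ω, f ω - g ω - h ω ∂μ = ∫ ω, f ω ∂μ - ∫ ω, g ω ∂μ - ∫ ω, h ω ∂μ := by
  have : Integrable (fun ω => f ω - g ω) μ := hf.sub hg
  rw [integral_sub this hh, integral_sub hf hg]

theorem _root_.MeasureTheory.MemLp.integrable_norm_sq {f : Ω → E} (hf : MemLp f 2 μ) :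
    Integrable (fun ω => ‖f ω‖ ^ 2) μ :=
  (memLp_two_iff_integrable_sq_norm hf.1).1 hf

theorem memLp_two_of_norm_sq_le {f : Ω → E} (hf : AEStronglyMeasurable f μ) {b : Ω → ℝ}
    (hb : Integrable b μ) (h : ∀ᵐ ω ∂μ, ‖f ω‖ ^ 2 ≤ b ω) : MemLp f 2 μ := by
  refine (memLp_two_iff_integrable_sq_norm hf).2 (hb.mono' (hf.norm.pow 2) ?_)
  filter_upwards [h] with ω hω
  simpa using hω

variable [InnerProductSpace ℝ E]

theorem _root_.MeasureTheory.MemLp.integrable_inner_two {f g : Ω → E} (hf : MemLp f 2 μ)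
    (hg : MemLp g 2 μ) : Integrable (fun ω => inner ℝ (f ω) (g ω)) μ := by
  refine Integrable.mono' (hf.integrable_norm_sq.add hg.integrable_norm_sq) (hf.1.inner hg.1)
    (Filter.Eventually.of_forall fun ω => ?_)
  have := abs_real_inner_le_norm (f ω) (g ω)
  simp only [Real.norm_eq_abs, Pi.add_apply]
  nlinarith [sq_nonneg (‖f ω‖ - ‖g ω‖), sq_nonneg ‖f ω‖, sq_nonneg ‖g ω‖]

theorem integral_norm_add_sq {f g : Ω → E} (hf : MemLp f 2 μ) (hg : MemLp g 2 μ) :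
    ∫ ω, ‖f ω + g ω‖ ^ 2 ∂μ
      = ∫ ω, ‖f ω‖ ^ 2 ∂μ + 2 * ∫ ω, inner ℝ (f ω) (g ω) ∂μ + ∫ ω, ‖g ω‖ ^ 2 ∂μ := by
  simp_rw [norm_add_sq_real]
  rw [integral_add₃ hf.integrable_norm_sq ((hf.integrable_inner_two hg).const_mul 2)
    hg.integrable_norm_sq, integral_const_mul]

/-- Centring only subtracts the squared norm of the mean. This lets noise differences be replaced by
differences of stochastic gradients. -/
theorem integral_norm_sub_mean_sq_le [CompleteSpace E] [IsProbabilityMeasure μ] {f : Ω → E}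
    (hf : MemLp f 2 μ) :
    ∫ ω, ‖f ω - ∫ ω', f ω' ∂μ‖ ^ 2 ∂μ ≤ ∫ ω, ‖f ω‖ ^ 2 ∂μ := by
  have hi : Integrable f μ := hf.integrable one_le_two
  have h := integral_norm_add_sq hf (memLp_const (-∫ ω', f ω' ∂μ))
  simp_rw [← sub_eq_add_neg] at h
  rw [h]
  have : ∫ ω, inner ℝ (f ω) (-∫ ω', f ω' ∂μ) ∂μ = -‖∫ ω', f ω' ∂μ‖ ^ 2 := by
    simp_rw [inner_neg_right, fun ω => real_inner_comm (∫ ω', f ω' ∂μ) (f ω)]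
    rw [integral_neg, integral_inner hi, real_inner_self_eq_norm_sq]
  rw [this]
  simp
  nlinarith [sq_nonneg ‖∫ ω', f ω' ∂μ‖]

/-- The second moment of a sum of pairwise orthogonal random vectors. -/
theorem integral_norm_sum_sq {α : Type*} (s : Finset α) {f : α → Ω → E}
    (hf : ∀ a ∈ s, MemLp (f a) 2 μ)
    (h : ∀ a ∈ s, ∀ b ∈ s, a ≠ b → ∫ ω, inner ℝ (f a ω) (f b ω) ∂μ = 0) :
    ∫ ω, ‖∑ a ∈ s, f a ω‖ ^ 2 ∂μ = ∑ a ∈ s, ∫ ω, ‖f a ω‖ ^ 2 ∂μ := by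
  have e : ∀ ω, ‖∑ a ∈ s, f a ω‖ ^ 2 = ∑ a ∈ s, ∑ b ∈ s, inner ℝ (f a ω) (f b ω) := by
    intro ω
    rw [← real_inner_self_eq_norm_sq, sum_inner]
    simp_rw [inner_sum]
  simp_rw [e]
  rw [integral_finsetSum _ fun a ha => integrable_finsetSum _ fun b hb =>
    (hf a ha).integrable_inner_two (hf b hb)]
  refine Finset.sum_congr rfl fun a ha => ?_
  rw [integral_finsetSum _ fun b hb => (hf a ha).integrable_inner_two (hf b hb),
    Finset.sum_eq_single_of_mem a ha fun b hb hab => h a ha b hb hab.symm]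
  simp_rw [real_inner_self_eq_norm_sq]

end SecondMoment

/-! ### Stochastic gradients -/

section StochasticGradient

variable {ι Ξ : Type*} [MeasurableSpace Ξ] {d : ℕ}

/-- The gradient noise `∇F_n(x, z) - ∇f_n(x)`. -/
def gradNoise (𝒟 : ι → Measure Ξ) (F : ι → EuclideanSpace ℝ (Fin d) → Ξ → ℝ) (n : ι)
    (x : EuclideanSpace ℝ (Fin d)) (z : Ξ) : EuclideanSpace ℝ (Fin d) :=
  stochGrad F n x z - gradient (localCost 𝒟 F n) x

variable [Fintype ι] {𝒟 : ι → Measure Ξ}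
  {F : ι → EuclideanSpace ℝ (Fin d) → Ξ → ℝ} {L : ℝ} {xs : EuclideanSpace ℝ (Fin d)}

namespace ConvexCosts

theorem sample (h : ConvexCosts 𝒟 F L xs) (n : ι) (z : Ξ) :
    SmoothConvex L (fun x => F n x z) (fun x => stochGrad F n x z) :=
  SmoothConvex.of_lSmooth (h.convex n z) (h.smooth n z)

/-- Only `F n x` is assumed measurable in the sample; each coordinate of the gradient is a pointwise
limit of difference quotients along the steps `1/(k + 1)`. -/
theorem measurable_stochGrad (h : ConvexCosts 𝒟 F L xs) (n : ι)
    (x : EuclideanSpace ℝ (Fin d)) : Measurable (stochGrad F n x) := by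
  have hcoord : ∀ i, Measurable fun z => stochGrad F n x z i := by
    intro i
    let e : EuclideanSpace ℝ (Fin d) := EuclideanSpace.single i 1
    refine measurable_of_tendsto_metrizable
      (f := fun (k : ℕ) z => ((k : ℝ) + 1) * (F n (x + (1 / ((k : ℝ) + 1)) • e) z - F n x z))
      (fun k => ((h.measurable n _).sub (h.measurable n _)).const_mul _) ?_
    rw [tendsto_pi_nhds]
    intro z
    have h1 : HasDerivAt (fun t : ℝ => F n (x + t • e) z) (inner ℝ (stochGrad F n x z) e) 0 := by
      have h2 : HasDerivAt (fun t : ℝ => x + t • e) e 0 := by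
        simpa using ((hasDerivAt_id (0 : ℝ)).smul_const e).const_add x
      have h3 := ((h.sample n z).hasGradientAt (x + (0 : ℝ) • e)).hasFDerivAt
      have := h3.comp_hasDerivAt 0 h2
      rw [zero_smul, add_zero] at this
      exact this
    have h4 := h1.tendsto_slope
    have h5 : Tendsto (fun k : ℕ => (1 / ((k : ℝ) + 1))) atTop (𝓝[≠] 0) :=
      tendsto_nhdsWithin_iff.2 ⟨tendsto_one_div_add_atTop_nhds_zero_nat,
        Filter.Eventually.of_forall fun k => by
          have : (0 : ℝ) < 1 / ((k : ℝ) + 1) := by positivity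
          exact this.ne'⟩
    have h6 := h4.comp h5
    have e1 : inner ℝ (stochGrad F n x z) e = stochGrad F n x z i := by
      simp [e, EuclideanSpace.inner_single_right]
    rw [e1] at h6
    refine h6.congr fun k => ?_
    simp [slope_def_field]
    ring
  exact (WithLp.measurable_toLp 2 (Fin d → ℝ)).comp (measurable_pi_iff.2 hcoord)

theorem measurable_uncurry_stochGrad (hL : 0 ≤ L) (h : ConvexCosts 𝒟 F L xs) (n : ι) :
    Measurable fun q : EuclideanSpace ℝ (Fin d) × Ξ => stochGrad F n q.1 q.2 :=
  measurable_uncurry_of_continuous_of_measurable (u := stochGrad F n)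
    (fun z => (h.sample n z).continuous_grad hL) (h.measurable_stochGrad n)

variable [∀ n, IsProbabilityMeasure (𝒟 n)]

/-- Finite noise is assumed at `x⋆` only; the Lipschitz gradients carry it to every point. The
gradient of the local cost at `x⋆` is a mere constant here, not yet known to be the mean. -/
theorem memLp_stochGrad (hL : 0 ≤ L) (h : ConvexCosts 𝒟 F L xs) (n : ι)
    (x : EuclideanSpace ℝ (Fin d)) : MemLp (stochGrad F n x) 2 (𝒟 n) := by
  have h1 : MemLp (fun z => stochGrad F n xs z - gradient (localCost 𝒟 F n) xs) 2 (𝒟 n) :=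
    (memLp_two_iff_integrable_sq_norm
      ((h.measurable_stochGrad n xs).sub_const _).aestronglyMeasurable).2 (h.finite_noise n)
  have h2 : MemLp (fun z => stochGrad F n x z - stochGrad F n xs z) 2 (𝒟 n) :=
    memLp_two_of_norm_sq_le
      ((h.measurable_stochGrad n x).sub (h.measurable_stochGrad n xs)).aestronglyMeasurable
      (integrable_const ((L * ‖x - xs‖) ^ 2)) (Filter.Eventually.of_forall fun z => by
        have := (h.sample n z).lipschitz hL x xs
        gcongr)
  have h3 := (h1.add h2).add (memLp_const (gradient (localCost 𝒟 F n) xs))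
  refine h3.ae_eq (Filter.Eventually.of_forall fun z => ?_)
  simp

theorem integrable_stochGrad (hL : 0 ≤ L) (h : ConvexCosts 𝒟 F L xs) (n : ι)
    (x : EuclideanSpace ℝ (Fin d)) : Integrable (stochGrad F n x) (𝒟 n) :=
  (h.memLp_stochGrad hL n x).integrable one_le_two

theorem localCost_aux (hL : 0 ≤ L) (h : ConvexCosts 𝒟 F L xs) (n : ι) :
    SmoothConvex L (localCost 𝒟 F n) (fun x => ∫ z, stochGrad F n x z ∂(𝒟 n)) := by
  have hin : ∀ x v, Integrable (fun z => inner ℝ (stochGrad F n x z) v) (𝒟 n) :=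
    fun x v => (h.integrable_stochGrad hL n x).inner_const v
  have hint : ∀ x v, inner ℝ (∫ z, stochGrad F n x z ∂(𝒟 n)) v
      = ∫ z, inner ℝ (stochGrad F n x z) v ∂(𝒟 n) := by
    intro x v
    simp_rw [real_inner_comm v]
    exact (integral_inner (h.integrable_stochGrad hL n x) v).symm
  constructor
  · intro x y
    rw [hint, localCost, localCost, ← integral_add (h.integrable n x) (hin _ _)]
    exact integral_mono ((h.integrable n x).add (hin _ _)) (h.integrable n y)
      fun z => (h.sample n z).lower x y
  · intro x y
    rw [hint, localCost, localCost, ← integral_add (h.integrable n x) (hin _ _)]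
    have := integral_mono (h.integrable n y) (((h.integrable n x).add (hin _ _)).add
      (integrable_const (L / 2 * ‖y - x‖ ^ 2)))
      fun z => (h.sample n z).upper x y
    refine this.trans_eq ?_
    simp_rw [Pi.add_apply]
    rw [integral_add₃ (h.integrable n x) (hin _ _) (integrable_const _),
      integral_add (h.integrable n x) (hin _ _)]
    simp

theorem gradient_localCost (hL : 0 ≤ L) (h : ConvexCosts 𝒟 F L xs) (n : ι)
    (x : EuclideanSpace ℝ (Fin d)) :
    gradient (localCost 𝒟 F n) x = ∫ z, stochGrad F n x z ∂(𝒟 n) :=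
  ((h.localCost_aux hL n).hasGradientAt x).gradient

theorem smoothConvex_localCost (hL : 0 ≤ L) (h : ConvexCosts 𝒟 F L xs) (n : ι) :
    SmoothConvex L (localCost 𝒟 F n) (gradient (localCost 𝒟 F n)) := by
  convert! h.localCost_aux hL n using 1
  ext1 x
  exact h.gradient_localCost hL n x

theorem smoothConvex_globalCost [Nonempty ι] (hL : 0 ≤ L) (h : ConvexCosts 𝒟 F L xs) :
    SmoothConvex L (globalCost 𝒟 F)
      (fun x => (1 / (Fintype.card ι : ℝ)) • ∑ n, gradient (localCost 𝒟 F n) x) := by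
  have hN : (0 : ℝ) < Fintype.card ι := by exact_mod_cast Fintype.card_pos
  constructor
  · intro x y
    simp only [globalCost]
    rw [real_inner_smul_left, sum_inner, ← mul_add, ← Finset.sum_add_distrib]
    gcongr with n
    exact (h.smoothConvex_localCost hL n).lower x y
  · intro x y
    simp only [globalCost]
    have e : L / 2 * ‖y - x‖ ^ 2
        = 1 / (Fintype.card ι : ℝ) * ∑ _n : ι, L / 2 * ‖y - x‖ ^ 2 := by
      rw [Finset.sum_const, Finset.card_univ, nsmul_eq_mul]
      field_simp
    rw [e, real_inner_smul_left, sum_inner, ← mul_add, ← mul_add, ← Finset.sum_add_distrib,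
      ← Finset.sum_add_distrib]
    gcongr with n
    exact (h.smoothConvex_localCost hL n).upper x y

theorem sum_gradient_eq_zero [Nonempty ι] (hL : 0 ≤ L) (h : ConvexCosts 𝒟 F L xs) :
    ∑ n, gradient (localCost 𝒟 F n) xs = 0 := by
  have hN : (0 : ℝ) < Fintype.card ι := by exact_mod_cast Fintype.card_pos
  have := (h.smoothConvex_globalCost hL).grad_eq_zero hL h.minimizer
  exact (smul_eq_zero.1 this).resolve_left (by positivity)

/-- The linear terms cancel because the local gradients sum to zero at `x⋆`. -/
theorem sum_bregman [Nonempty ι] (hL : 0 ≤ L) (h : ConvexCosts 𝒟 F L xs)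
    (y : EuclideanSpace ℝ (Fin d)) :
    ∑ n, bregman (localCost 𝒟 F n) (gradient (localCost 𝒟 F n)) y xs
      = Fintype.card ι * (globalCost 𝒟 F y - globalCost 𝒟 F xs) := by
  have hN : (0 : ℝ) < Fintype.card ι := by exact_mod_cast Fintype.card_pos
  simp only [bregman, Finset.sum_sub_distrib, ← sum_inner, h.sum_gradient_eq_zero hL, globalCost]
  simp
  field_simp

/-- Pass from `x` to `y` by the Lipschitz bound and from `y` to `x⋆` by cocoercivity. With `y` the
average, summing over nodes yields the deviations and the optimality gap. -/
theorem gradient_sq_le (hL : 0 ≤ L) (h : ConvexCosts 𝒟 F L xs) (n : ι)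
    (x y : EuclideanSpace ℝ (Fin d)) :
    ‖gradient (localCost 𝒟 F n) x‖ ^ 2 ≤ 3 * L ^ 2 * ‖x - y‖ ^ 2
      + 6 * L * bregman (localCost 𝒟 F n) (gradient (localCost 𝒟 F n)) y xs
      + 3 * ‖gradient (localCost 𝒟 F n) xs‖ ^ 2 := by
  have hs := h.smoothConvex_localCost hL n
  have h1 := norm_add₃_sq_le (gradient (localCost 𝒟 F n) x - gradient (localCost 𝒟 F n) y)
    (gradient (localCost 𝒟 F n) y - gradient (localCost 𝒟 F n) xs)
    (gradient (localCost 𝒟 F n) xs)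
  have h2 := hs.cocoercive hL y xs
  have h3 := pow_le_pow_left₀ (norm_nonneg _) (hs.lipschitz hL x y) 2
  rw [sub_add_sub_cancel, sub_add_cancel] at h1
  nlinarith

theorem memLp_gradNoise (hL : 0 ≤ L) (h : ConvexCosts 𝒟 F L xs) (n : ι)
    (x : EuclideanSpace ℝ (Fin d)) : MemLp (gradNoise 𝒟 F n x) 2 (𝒟 n) :=
  (h.memLp_stochGrad hL n x).sub (memLp_const _)

theorem integral_gradNoise (hL : 0 ≤ L) (h : ConvexCosts 𝒟 F L xs) (n : ι)
    (x : EuclideanSpace ℝ (Fin d)) : ∫ z, gradNoise 𝒟 F n x z ∂(𝒟 n) = 0 := by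
  simp only [gradNoise]
  rw [integral_sub (h.integrable_stochGrad hL n x) (integrable_const _),
    h.gradient_localCost hL]
  simp

/-- Cocoercivity holds for each sample, and the mean of the samplewise Bregman divergences is that
of the local objective. This is where convexity of each sampled cost, not just of `f`, is needed. -/
theorem integral_stochGrad_sub_sq_le (hL : 0 ≤ L) (h : ConvexCosts 𝒟 F L xs) (n : ι)
    (x y : EuclideanSpace ℝ (Fin d)) :
    ∫ z, ‖stochGrad F n x z - stochGrad F n y z‖ ^ 2 ∂(𝒟 n)
      ≤ 2 * L * bregman (localCost 𝒟 F n) (gradient (localCost 𝒟 F n)) x y := by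
  have hi : Integrable (fun z => inner ℝ (stochGrad F n y z) (x - y)) (𝒟 n) :=
    (h.integrable_stochGrad hL n y).inner_const _
  have e : bregman (localCost 𝒟 F n) (gradient (localCost 𝒟 F n)) x y
      = ∫ z, bregman (fun x => F n x z) (fun x => stochGrad F n x z) x y ∂(𝒟 n) := by
    simp only [bregman]
    rw [integral_sub₃ (h.integrable n x) (h.integrable n y) hi, h.gradient_localCost hL,
      real_inner_comm, ← integral_inner (h.integrable_stochGrad hL n y)]
    simp_rw [real_inner_comm (x - y)]
    rfl
  rw [e, ← integral_const_mul]
  refine integral_mono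
    ((h.memLp_stochGrad hL n x).sub (h.memLp_stochGrad hL n y)).integrable_norm_sq
    ((((h.integrable n x).sub (h.integrable n y)).sub hi).const_mul _) fun z => ?_
  exact (h.sample n z).cocoercive hL x y

theorem integral_gradNoise_sub_sq_le (hL : 0 ≤ L) (h : ConvexCosts 𝒟 F L xs) (n : ι)
    (x y : EuclideanSpace ℝ (Fin d)) :
    ∫ z, ‖gradNoise 𝒟 F n x z - gradNoise 𝒟 F n y z‖ ^ 2 ∂(𝒟 n)
      ≤ ∫ z, ‖stochGrad F n x z - stochGrad F n y z‖ ^ 2 ∂(𝒟 n) := by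
  refine (le_of_eq ?_).trans (integral_norm_sub_mean_sq_le
    ((h.memLp_stochGrad hL n x).sub (h.memLp_stochGrad hL n y)))
  simp only [gradNoise]
  rw [integral_sub (h.integrable_stochGrad hL n x) (h.integrable_stochGrad hL n y),
    ← h.gradient_localCost hL, ← h.gradient_localCost hL]
  congr 1 with z
  congr 2
  abel

/-- The same three-term split as for `gradient_sq_le`, now in mean square over the sample. -/
theorem integral_gradNoise_sq_le (hL : 0 ≤ L) (h : ConvexCosts 𝒟 F L xs) (n : ι)
    (x y : EuclideanSpace ℝ (Fin d)) :
    ∫ z, ‖gradNoise 𝒟 F n x z‖ ^ 2 ∂(𝒟 n) ≤ 3 * L ^ 2 * ‖x - y‖ ^ 2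
      + 6 * L * bregman (localCost 𝒟 F n) (gradient (localCost 𝒟 F n)) y xs
      + 3 * noiseSq 𝒟 F xs n := by
  have hx := h.memLp_gradNoise hL n x
  have hy := h.memLp_gradNoise hL n y
  have hs := h.memLp_gradNoise hL n xs
  have i1 := (hx.sub hy).integrable_norm_sq.const_mul 3
  have i2 := (hy.sub hs).integrable_norm_sq.const_mul 3
  have i3 := hs.integrable_norm_sq.const_mul 3
  have h1 := integral_mono hx.integrable_norm_sq ((i1.add i2).add i3) fun z => by
    have := norm_add₃_sq_le (gradNoise 𝒟 F n x z - gradNoise 𝒟 F n y z)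
      (gradNoise 𝒟 F n y z - gradNoise 𝒟 F n xs z) (gradNoise 𝒟 F n xs z)
    rw [sub_add_sub_cancel, sub_add_cancel] at this
    exact this
  simp only [Pi.add_apply, Pi.sub_apply] at h1 i1 i2 i3
  rw [integral_add₃ i1 i2 i3, integral_const_mul, integral_const_mul,
    integral_const_mul] at h1
  have h2 : ∫ z, ‖gradNoise 𝒟 F n x z - gradNoise 𝒟 F n y z‖ ^ 2 ∂(𝒟 n)
      ≤ L ^ 2 * ‖x - y‖ ^ 2 := by
    refine (h.integral_gradNoise_sub_sq_le hL n x y).trans ?_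
    have := integral_mono ((h.memLp_stochGrad hL n x).sub
      (h.memLp_stochGrad hL n y)).integrable_norm_sq
      (integrable_const (μ := 𝒟 n) ((L * ‖x - y‖) ^ 2)) fun z => by
        have := (h.sample n z).lipschitz hL x y
        simp only [Pi.sub_apply]
        gcongr
    refine this.trans_eq ?_
    simp [mul_pow]
  have h3 := (h.integral_gradNoise_sub_sq_le hL n y xs).trans
    (h.integral_stochGrad_sub_sq_le hL n y xs)
  have h4 : ∫ z, ‖gradNoise 𝒟 F n xs z‖ ^ 2 ∂(𝒟 n) = noiseSq 𝒟 F xs n := rfl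
  nlinarith

theorem measurable_gradNoise (hL : 0 ≤ L)
    (h : ConvexCosts 𝒟 F L xs) (n : ι) :
    Measurable fun q : EuclideanSpace ℝ (Fin d) × Ξ => gradNoise 𝒟 F n q.1 q.2 :=
  (h.measurable_uncurry_stochGrad hL n).sub
    (((h.smoothConvex_localCost hL n).continuous_grad hL).measurable.comp measurable_fst)

end ConvexCosts

end StochasticGradient

/-! ### Independence -/

section Independence

theorem iSup_comap_le_comap_pi {Ω α : Type*} {β : α → Type*} [∀ a, MeasurableSpace (β a)]
    (f : ∀ a, Ω → β a) :
    (⨆ a, MeasurableSpace.comap (f a) inferInstance)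
      ≤ MeasurableSpace.comap (fun ω a => f a ω) inferInstance := by
  refine iSup_le fun a => ?_
  rintro s ⟨t, ht, rfl⟩
  exact ⟨(fun g => g a) ⁻¹' t, measurable_pi_apply a ht, rfl⟩

variable {Ω : Type*} [mΩ : MeasurableSpace Ω] {μ : Measure Ω}

/-- Two independent families of independent σ-algebras form one such family. -/
theorem iIndep_sumElim {α β : Type*} {m₁ : α → MeasurableSpace Ω} {m₂ : β → MeasurableSpace Ω}
    (h₁ : iIndep m₁ μ) (h₂ : iIndep m₂ μ) (h : Indep (⨆ a, m₁ a) (⨆ b, m₂ b) μ) :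
    iIndep (Sum.elim m₁ m₂) μ := by
  rw [iIndep_iff] at h₁ h₂ ⊢
  intro s f hf
  have e : (⋂ i ∈ s, f i)
      = (⋂ a ∈ s.toLeft, f (.inl a)) ∩ ⋂ b ∈ s.toRight, f (.inr b) := by
    ext ω
    simp
  rw [e]
  have hl : ∀ a ∈ s.toLeft, MeasurableSet[m₁ a] (f (.inl a)) :=
    fun a ha => hf (.inl a) (Finset.mem_toLeft.1 ha)
  have hr : ∀ b ∈ s.toRight, MeasurableSet[m₂ b] (f (.inr b)) :=
    fun b hb => hf (.inr b) (Finset.mem_toRight.1 hb)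
  rw [(Indep_iff _ _ _).1 h _ _
    (Finset.measurableSet_biInter _ fun a ha => le_iSup m₁ a _ (hl a ha))
    (Finset.measurableSet_biInter _ fun b hb => le_iSup m₂ b _ (hr b hb)),
    h₁ _ hl, h₂ _ hr]
  conv_rhs => rw [← s.toLeft_disjSum_toRight, Finset.prod_disjSum]

variable {α β : Type*} [MeasurableSpace α] [MeasurableSpace β] {U : Ω → α} {V : Ω → β}

theorem indepFun_of_indep {m₁ m₂ : MeasurableSpace Ω} (h : Indep m₁ m₂ μ)
    (hU : Measurable[m₁] U) (hV : Measurable[m₂] V) : IndepFun U V μ :=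
  indep_of_indep_of_le_left (indep_of_indep_of_le_right h hV.comap_le) hU.comap_le

variable [IsProbabilityMeasure μ]

/-- If the partial means of `h (u, V)` vanish then so does the mean of `h (U, V)`. -/
theorem integral_eq_zero_of_indepFun (hU : Measurable U) (hV : Measurable V)
    (hUV : IndepFun U V μ) {h : α × β → ℝ} (hh : Measurable h)
    (hint : Integrable (fun ω => h (U ω, V ω)) μ)
    (h0 : ∀ u, ∫ v, h (u, v) ∂(μ.map V) = 0) : ∫ ω, h (U ω, V ω) ∂μ = 0 := by
  have hmap := (indepFun_iff_map_prod_eq_prod_map_map hU.aemeasurable hV.aemeasurable).1 hUV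
  have hpair : Measurable fun ω => (U ω, V ω) := hU.prodMk hV
  have := Measure.isProbabilityMeasure_map (μ := μ) hU.aemeasurable
  have := Measure.isProbabilityMeasure_map (μ := μ) hV.aemeasurable
  have hint' : Integrable h ((μ.map U).prod (μ.map V)) := by
    rw [← hmap]
    exact (integrable_map_measure hh.aestronglyMeasurable hpair.aemeasurable).2 hint
  have := integral_map (μ := μ) hpair.aemeasurable hh.aestronglyMeasurable
  rw [← this, hmap, integral_prod _ hint']
  simp [h0]

/-- If the partial means of `h (u, V)` are at most `b u` then the mean of `h (U, V)` is at most
that of `b U`. -/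
theorem integral_le_of_indepFun (hU : Measurable U) (hV : Measurable V)
    (hUV : IndepFun U V μ) {h : α × β → ℝ} (hh : Measurable h) (hnn : ∀ q, 0 ≤ h q)
    {b : α → ℝ} (hb : Integrable (fun ω => b (U ω)) μ) (hbm : Measurable b)
    (hi : ∀ u, Integrable (fun v => h (u, v)) (μ.map V))
    (hle : ∀ u, ∫ v, h (u, v) ∂(μ.map V) ≤ b u) :
    Integrable (fun ω => h (U ω, V ω)) μ ∧ ∫ ω, h (U ω, V ω) ∂μ ≤ ∫ ω, b (U ω) ∂μ := by
  have hmap := (indepFun_iff_map_prod_eq_prod_map_map hU.aemeasurable hV.aemeasurable).1 hUV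
  have hpair : Measurable fun ω => (U ω, V ω) := hU.prodMk hV
  have := Measure.isProbabilityMeasure_map (μ := μ) hU.aemeasurable
  have := Measure.isProbabilityMeasure_map (μ := μ) hV.aemeasurable
  have hb' : Integrable b (μ.map U) :=
    (integrable_map_measure hbm.aestronglyMeasurable hU.aemeasurable).2 hb
  have hnorm : ∀ q, ‖h q‖ = h q := fun q => by rw [Real.norm_eq_abs, abs_of_nonneg (hnn q)]
  have hint' : Integrable h ((μ.map U).prod (μ.map V)) := by
    rw [integrable_prod_iff hh.aestronglyMeasurable]
    refine ⟨Filter.Eventually.of_forall hi, ?_⟩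
    simp_rw [hnorm]
    refine hb'.mono' ?_ (Filter.Eventually.of_forall fun u => ?_)
    · exact hh.stronglyMeasurable.integral_prod_right'.aestronglyMeasurable
    · rw [Real.norm_eq_abs, abs_of_nonneg (integral_nonneg fun v => hnn _)]
      exact hle u
  refine ⟨(integrable_map_measure hh.aestronglyMeasurable hpair.aemeasurable).1
    (by rw [hmap]; exact hint'), ?_⟩
  rw [← integral_map (μ := μ) hpair.aemeasurable hh.aestronglyMeasurable, hmap,
    integral_prod _ hint', ← integral_map hU.aemeasurable hbm.aestronglyMeasurable]
  exact integral_mono hint'.integral_prod_left hb' hle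

end Independence

/-! ### Noise at a random point -/

section Noise

variable {Ω ι Ξ : Type*} {m : MeasurableSpace Ω} [mΩ : MeasurableSpace Ω] [MeasurableSpace Ξ]
  [Fintype ι] {μ : Measure Ω}
  [IsProbabilityMeasure μ] {d : ℕ} {𝒟 : ι → Measure Ξ} [∀ n, IsProbabilityMeasure (𝒟 n)]
  {F : ι → EuclideanSpace ℝ (Fin d) → Ξ → ℝ} {L : ℝ} {xs : EuclideanSpace ℝ (Fin d)}
  {V : Ω → Ξ} {x y Z : Ω → EuclideanSpace ℝ (Fin d)} {n : ι}

namespace ConvexCosts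

/-- With `x` and `Z` frozen, the noise has mean zero under the law of the independent sample; Fubini
does the rest. -/
theorem integral_inner_gradNoise (hL : 0 ≤ L) (h : ConvexCosts 𝒟 F L xs) (hm : m ≤ mΩ)
    (hV : Measurable V) (hlaw : μ.map V = 𝒟 n)
    (hind : Indep m (MeasurableSpace.comap V inferInstance) μ)
    (hx : Measurable[m] x) (hZ : Measurable[m] Z)
    (hint : Integrable (fun ω => inner ℝ (Z ω) (gradNoise 𝒟 F n (x ω) (V ω))) μ) :
    ∫ ω, inner ℝ (Z ω) (gradNoise 𝒟 F n (x ω) (V ω)) ∂μ = 0 := by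
  have hU : Measurable[m] fun ω => (x ω, Z ω) := hx.prodMk hZ
  have hmeas := h.measurable_gradNoise hL n
  refine integral_eq_zero_of_indepFun (hU.mono hm le_rfl) hV
    (indepFun_of_indep hind hU (comap_measurable V))
    (h := fun q => inner ℝ q.1.2 (gradNoise 𝒟 F n q.1.1 q.2)) ?_ hint ?_
  · exact (measurable_snd.comp measurable_fst).inner
      (hmeas.comp ((measurable_fst.comp measurable_fst).prodMk measurable_snd))
  · intro u
    rw [hlaw]
    refine (integral_inner ((h.memLp_gradNoise hL n u.1).integrable one_le_two) u.2).trans ?_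
    rw [h.integral_gradNoise hL, inner_zero_right]

/-- The noise at the random point `x`, estimated with the help of a reference point `y`. -/
theorem integral_gradNoise_comp_sq_le (hL : 0 ≤ L) (h : ConvexCosts 𝒟 F L xs) (hm : m ≤ mΩ)
    (hV : Measurable V) (hlaw : μ.map V = 𝒟 n)
    (hind : Indep m (MeasurableSpace.comap V inferInstance) μ)
    (hx : Measurable[m] x) (hy : Measurable[m] y)
    (hb : Integrable (fun ω => 3 * L ^ 2 * ‖x ω - y ω‖ ^ 2
      + 6 * L * bregman (localCost 𝒟 F n) (gradient (localCost 𝒟 F n)) (y ω) xs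
      + 3 * noiseSq 𝒟 F xs n) μ) :
    MemLp (fun ω => gradNoise 𝒟 F n (x ω) (V ω)) 2 μ ∧
    ∫ ω, ‖gradNoise 𝒟 F n (x ω) (V ω)‖ ^ 2 ∂μ ≤ ∫ ω, (3 * L ^ 2 * ‖x ω - y ω‖ ^ 2
      + 6 * L * bregman (localCost 𝒟 F n) (gradient (localCost 𝒟 F n)) (y ω) xs
      + 3 * noiseSq 𝒟 F xs n) ∂μ := by
  have hU : Measurable[m] fun ω => (x ω, y ω) := hx.prodMk hy
  have hmeas := h.measurable_gradNoise hL n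
  have hs := h.smoothConvex_localCost hL n
  have key := integral_le_of_indepFun (μ := μ) (hU.mono hm le_rfl) hV
    (indepFun_of_indep hind hU (comap_measurable V))
    (h := fun q => ‖gradNoise 𝒟 F n q.1.1 q.2‖ ^ 2)
    ((hmeas.comp ((measurable_fst.comp measurable_fst).prodMk measurable_snd)).norm.pow_const 2)
    (fun q => by positivity)
    (b := fun u => 3 * L ^ 2 * ‖u.1 - u.2‖ ^ 2
      + 6 * L * bregman (localCost 𝒟 F n) (gradient (localCost 𝒟 F n)) u.2 xs
      + 3 * noiseSq 𝒟 F xs n) hb ?_ ?_ ?_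
  · refine ⟨(memLp_two_iff_integrable_sq_norm ?_).2 key.1, key.2⟩
    exact (hmeas.comp ((hx.mono hm le_rfl).prodMk hV)).aestronglyMeasurable
  · have hc := hs.continuous
    unfold bregman
    have : Continuous fun u : EuclideanSpace ℝ (Fin d) × EuclideanSpace ℝ (Fin d) =>
        3 * L ^ 2 * ‖u.1 - u.2‖ ^ 2 + 6 * L * (localCost 𝒟 F n u.2 - localCost 𝒟 F n xs -
          inner ℝ (gradient (localCost 𝒟 F n) xs) (u.2 - xs)) + 3 * noiseSq 𝒟 F xs n := by
      fun_prop
    exact this.measurable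
  · intro u
    rw [hlaw]
    exact (h.memLp_gradNoise hL n u.1).integrable_norm_sq
  · intro u
    rw [hlaw]
    exact h.integral_gradNoise_sq_le hL n u.1 u.2

end ConvexCosts

end Noise

/-! ### Matrices acting on stacked states -/

section Action

/-- The stacked states of the nodes, with the `ℓ²` norm. -/
def Stack (V : Type*) (d : ℕ) := PiLp 2 fun _ : V => EuclideanSpace ℝ (Fin d)

variable {V : Type*} {d : ℕ}

instance : CoeFun (Stack V d) fun _ => V → EuclideanSpace ℝ (Fin d) := ⟨WithLp.ofLp⟩

/-- The stack with given entries. -/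
def Stack.mk (x : V → EuclideanSpace ℝ (Fin d)) : Stack V d := WithLp.toLp 2 x

@[simp] theorem Stack.mk_apply (x : V → EuclideanSpace ℝ (Fin d)) (i : V) :
    Stack.mk x i = x i := rfl

variable [Fintype V]

instance : NormedAddCommGroup (Stack V d) :=
  inferInstanceAs (NormedAddCommGroup (PiLp 2 fun _ : V => EuclideanSpace ℝ (Fin d)))

instance : InnerProductSpace ℝ (Stack V d) :=
  inferInstanceAs (InnerProductSpace ℝ (PiLp 2 fun _ : V => EuclideanSpace ℝ (Fin d)))

instance : SecondCountableTopology (Stack V d) :=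
  inferInstanceAs (SecondCountableTopology (PiLp 2 fun _ : V => EuclideanSpace ℝ (Fin d)))

instance : MeasurableSpace (Stack V d) :=
  inferInstanceAs (MeasurableSpace (PiLp 2 fun _ : V => EuclideanSpace ℝ (Fin d)))

instance : BorelSpace (Stack V d) :=
  inferInstanceAs (BorelSpace (PiLp 2 fun _ : V => EuclideanSpace ℝ (Fin d)))

namespace Stack

@[ext] theorem ext {X Y : Stack V d} (h : ∀ i, X i = Y i) : X = Y := PiLp.ext h

@[simp] theorem add_apply (X Y : Stack V d) (i : V) : (X + Y) i = X i + Y i := rfl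

@[simp] theorem sub_apply (X Y : Stack V d) (i : V) : (X - Y) i = X i - Y i := rfl

@[simp] theorem smul_apply (c : ℝ) (X : Stack V d) (i : V) : (c • X) i = c • X i := rfl

@[simp] theorem zero_apply (i : V) : (0 : Stack V d) i = 0 := rfl

@[simp] theorem sum_apply {α : Type*} (s : Finset α) (X : α → Stack V d) (i : V) :
    (∑ a ∈ s, X a) i = ∑ a ∈ s, X a i := by
  classical
  induction s using Finset.induction_on with
  | empty => simp
  | insert a s ha ih => rw [Finset.sum_insert ha, Finset.sum_insert ha, add_apply, ih]

theorem norm_sq_eq (X : Stack V d) : ‖X‖ ^ 2 = ∑ i, ‖X i‖ ^ 2 :=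
  PiLp.norm_sq_eq_of_L2 _ X

theorem inner_eq (X Y : Stack V d) : inner ℝ X Y = ∑ i, inner ℝ (X i) (Y i) :=
  PiLp.inner_apply X Y

theorem measurable_mk {Ω : Type*} {m : MeasurableSpace Ω}
    {x : Ω → V → EuclideanSpace ℝ (Fin d)} (hx : ∀ i, Measurable fun ω => x ω i) :
    Measurable fun ω => Stack.mk (x ω) :=
  (WithLp.measurable_toLp 2 _).comp (measurable_pi_iff.2 hx)

theorem measurable_eval {Ω : Type*} {m : MeasurableSpace Ω} {X : Ω → Stack V d}
    (hX : Measurable X) (i : V) : Measurable fun ω => X ω i :=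
  (measurable_pi_apply i).comp ((WithLp.measurable_ofLp 2 _).comp hX)

theorem memLp_iff {Ω : Type*} {m : MeasurableSpace Ω} {μ : Measure Ω} {X : Ω → Stack V d} :
    MemLp X 2 μ ↔ ∀ i, MemLp (fun ω => X ω i) 2 μ :=
  memLp_piLp_iff

end Stack

/-- The action of a matrix on stacked states. -/
def act (A : Matrix V V ℝ) : Stack V d →ₗ[ℝ] Stack V d where
  toFun Z := Stack.mk fun i => ∑ j, A i j • Z j
  map_add' X Y := by ext1 i; simp [Finset.sum_add_distrib]
  map_smul' c X := by
    ext1 i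
    simp only [Stack.mk_apply, Stack.smul_apply, Finset.smul_sum, RingHom.id_apply]
    exact Finset.sum_congr rfl fun _ _ => smul_comm _ _ _

@[simp] theorem act_apply (A : Matrix V V ℝ) (Z : Stack V d) (i : V) :
    act A Z i = ∑ j, A i j • Z j := rfl

theorem act_sub_matrix (A B : Matrix V V ℝ) (Z : Stack V d) :
    act (A - B) Z = act A Z - act B Z := by
  ext1 i
  simp [sub_smul, Finset.sum_sub_distrib]

theorem act_mul (A B : Matrix V V ℝ) (Z : Stack V d) : act (A * B) Z = act A (act B Z) := by
  ext1 i
  simp only [act_apply, Matrix.mul_apply, Finset.sum_smul, Finset.smul_sum, smul_smul]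
  exact Finset.sum_comm

theorem measurable_act {Ω : Type*} {m : MeasurableSpace Ω} {A : Ω → Matrix V V ℝ}
    {Z : Ω → Stack V d} (hA : ∀ i j, Measurable fun ω => A ω i j) (hZ : Measurable Z) :
    Measurable fun ω => act (A ω) (Z ω) :=
  Stack.measurable_mk fun i =>
    Finset.measurable_sum _ fun j _ => (hA i j).smul (Stack.measurable_eval hZ j)

variable [DecidableEq V]

theorem act_one (Z : Stack V d) : act 1 Z = Z := by
  ext1 i
  simp [Matrix.one_apply]

/-- The matrix acts on each of the `d` coordinate columns separately, and the squared norms of the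
columns add up. -/
theorem norm_act_le (A : Matrix V V ℝ) (Z : Stack V d) :
    ‖act A Z‖ ≤ specNorm A * ‖Z‖ := by
  have hcol : ∀ (Y : Stack V d), ‖Y‖ ^ 2
      = ∑ c, ‖(WithLp.toLp 2 fun i => Y i c : EuclideanSpace ℝ V)‖ ^ 2 := by
    intro Y
    simp_rw [Stack.norm_sq_eq, PiLp.norm_sq_eq_of_L2]
    exact Finset.sum_comm
  have hA : 0 ≤ specNorm A := norm_nonneg _
  refine (abs_le_of_sq_le_sq' ?_ (by positivity)).2
  rw [mul_pow, hcol, hcol Z, Finset.mul_sum]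
  refine Finset.sum_le_sum fun c _ => ?_
  rw [← mul_pow]
  refine pow_le_pow_left₀ (norm_nonneg _) ?_ 2
  have := (Matrix.toEuclideanCLM (n := V) (𝕜 := ℝ) A).le_opNorm
    (WithLp.toLp 2 fun i => Z i c)
  refine le_trans (le_of_eq ?_) this
  congr 1
  ext i
  simp [Matrix.mulVec, dotProduct]

theorem measurable_specNorm {Ω : Type*} {m : MeasurableSpace Ω} {A : Ω → Matrix V V ℝ}
    (hA : ∀ i j, Measurable fun ω => A ω i j) : Measurable fun ω => specNorm (A ω) := by
  let T : (V → V → ℝ) →ₗ[ℝ] (EuclideanSpace ℝ V →L[ℝ] EuclideanSpace ℝ V) :=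
    (Matrix.toEuclideanCLM (n := V) (𝕜 := ℝ)).toAlgEquiv.toLinearMap ∘ₗ
      (Matrix.ofLinearEquiv ℝ).toLinearMap
  have hT : Continuous T := T.continuous_of_finiteDimensional
  have h2 : Measurable fun ω => (fun i j => A ω i j : V → V → ℝ) :=
    measurable_pi_iff.2 fun i => measurable_pi_iff.2 fun j => hA i j
  exact (hT.norm.measurable).comp h2

/-- A random matrix acting on an independent random state. -/
theorem memLp_act_of_indep {Ω : Type*} {m₁ m₂ : MeasurableSpace Ω}
    [mΩ : MeasurableSpace Ω] {μ : Measure Ω} (h₁ : m₁ ≤ mΩ) (h₂ : m₂ ≤ mΩ) (hind : Indep m₁ m₂ μ)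
    {A : Ω → Matrix V V ℝ} {Z : Ω → Stack V d}
    (hA : ∀ i j, Measurable[m₁] fun ω => A ω i j) (hZ : Measurable[m₂] Z)
    (hAi : Integrable (fun ω => specNorm (A ω) ^ 2) μ) (hZi : MemLp Z 2 μ) :
    MemLp (fun ω => act (A ω) (Z ω)) 2 μ ∧ ∫ ω, ‖act (A ω) (Z ω)‖ ^ 2 ∂μ
      ≤ (∫ ω, specNorm (A ω) ^ 2 ∂μ) * ∫ ω, ‖Z ω‖ ^ 2 ∂μ := by
  have hI : IndepFun (fun ω => specNorm (A ω) ^ 2) (fun ω => ‖Z ω‖ ^ 2) μ :=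
    indepFun_of_indep hind ((measurable_specNorm hA).pow_const 2) ((measurable_norm.pow_const 2).comp hZ)
  have hi : Integrable (fun ω => specNorm (A ω) ^ 2 * ‖Z ω‖ ^ 2) μ :=
    hI.integrable_mul hAi hZi.integrable_norm_sq
  have hle : ∀ ω, ‖act (A ω) (Z ω)‖ ^ 2 ≤ specNorm (A ω) ^ 2 * ‖Z ω‖ ^ 2 := fun ω => by
    rw [← mul_pow]
    exact pow_le_pow_left₀ (norm_nonneg _) (norm_act_le _ _) 2
  have hmem := memLp_two_of_norm_sq_le (measurable_act (fun i j => (hA i j).mono h₁ le_rfl)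
    (hZ.mono h₂ le_rfl)).aestronglyMeasurable hi (Filter.Eventually.of_forall hle)
  refine ⟨hmem, ?_⟩
  rw [← hI.integral_fun_mul_eq_mul_integral hAi.1 hZi.integrable_norm_sq.1]
  exact integral_mono hmem.integrable_norm_sq hi hle

end Action

/-! ### The flow of information -/

section Information

variable {ι κ Ω Ξ : Type*} [MeasurableSpace Ξ]

/-- The information in the weight matrix of a round, or in one sample. -/
@[reducible]
def info (W : ℕ → Ω → Matrix (ι ⊕ κ) (ι ⊕ κ) ℝ) (ξ : ℕ → ι → Ω → Ξ) :
    ℕ ⊕ ℕ × ι → MeasurableSpace Ω :=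
  Sum.elim
    (fun k => MeasurableSpace.comap (fun ω (i j : ι ⊕ κ) => W k ω i j) inferInstance)
    (fun q => MeasurableSpace.comap (ξ q.1 q.2) inferInstance)

/-- The information in a set of weight matrices and samples. -/
@[reducible]
def infoOn (W : ℕ → Ω → Matrix (ι ⊕ κ) (ι ⊕ κ) ℝ) (ξ : ℕ → ι → Ω → Ξ)
    (S : Set (ℕ ⊕ ℕ × ι)) : MeasurableSpace Ω :=
  ⨆ i ∈ S, info W ξ i

variable {W : ℕ → Ω → Matrix (ι ⊕ κ) (ι ⊕ κ) ℝ} {ξ : ℕ → ι → Ω → Ξ} {S : Set (ℕ ⊕ ℕ × ι)}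

theorem info_le_infoOn {i : ℕ ⊕ ℕ × ι} (hi : i ∈ S) : info W ξ i ≤ infoOn W ξ S :=
  le_iSup₂ (f := fun i _ => info W ξ i) i hi

theorem measurable_weight_infoOn {k : ℕ} (hk : .inl k ∈ S) (i j : ι ⊕ κ) :
    Measurable[infoOn W ξ S] fun ω => W k ω i j := by
  have h : Measurable[info W ξ (.inl k)] fun ω (i j : ι ⊕ κ) => W k ω i j := comap_measurable _
  exact (((measurable_pi_apply j).comp (measurable_pi_apply i)).comp h).mono
    (info_le_infoOn hk) le_rfl

theorem measurable_sample_infoOn {k : ℕ} {n : ι} (hk : .inr (k, n) ∈ S) :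
    Measurable[infoOn W ξ S] (ξ k n) := by
  have h : Measurable[info W ξ (.inr (k, n))] (ξ k n) := comap_measurable _
  exact h.mono (info_le_infoOn hk) le_rfl

variable [Fintype ι] [DecidableEq ι] [Fintype κ] [DecidableEq κ] [mΩ : MeasurableSpace Ω]
  {μ : Measure Ω} {𝒟 : ι → Measure Ξ}

namespace RandomModel

theorem info_le (h : RandomModel μ W 𝒟 ξ) (i : ℕ ⊕ ℕ × ι) : info W ξ i ≤ mΩ := by
  rcases i with k | q
  · exact (measurable_pi_iff.2 fun i => measurable_pi_iff.2 fun j =>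
      h.measurable_weight k i j).comap_le
  · exact (h.measurable_sample q.1 q.2).comap_le

theorem infoOn_le (h : RandomModel μ W 𝒟 ξ) (S : Set (ℕ ⊕ ℕ × ι)) : infoOn W ξ S ≤ mΩ :=
  iSup₂_le fun i _ => h.info_le i

theorem iIndep_info (h : RandomModel μ W 𝒟 ξ) : iIndep (info W ξ) μ :=
  iIndep_sumElim h.indep_weight h.indep_sample
    (indep_of_indep_of_le_left (indep_of_indep_of_le_right h.indep
      (iSup_comap_le_comap_pi fun i : ℕ × ι => ξ i.1 i.2))
      (iSup_comap_le_comap_pi fun k ω (i j : ι ⊕ κ) => W k ω i j))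

theorem indep_infoOn (h : RandomModel μ W 𝒟 ξ) {S T : Set (ℕ ⊕ ℕ × ι)} (hST : Disjoint S T) :
    Indep (infoOn W ξ S) (infoOn W ξ T) μ :=
  indep_iSup_of_disjoint h.info_le h.iIndep_info hST

theorem indep_sample_infoOn (h : RandomModel μ W 𝒟 ξ) (k : ℕ) (n : ι) :
    Indep (infoOn W ξ {.inr (k, n)}ᶜ) (MeasurableSpace.comap (ξ k n) inferInstance) μ :=
  indep_of_indep_of_le_right (h.indep_infoOn disjoint_compl_left)
    (info_le_infoOn (W := W) (ξ := ξ) (i := .inr (k, n)) (Set.mem_singleton _))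

end RandomModel

end Information

/-! ### Measurability of products and iterates -/

section Measurability

variable {ι κ Ω Ξ : Type*} [Fintype ι] [Fintype κ] {d : ℕ} {m : MeasurableSpace Ω}
  [MeasurableSpace Ξ]

theorem measurable_gossipProd {V : Type*} [Fintype V] [DecidableEq V]
    {W : ℕ → Ω → Matrix V V ℝ} {s r : ℕ}
    (hW : ∀ k, s ≤ k → k < s + r → ∀ i j, Measurable fun ω => W k ω i j) (i j : V) :
    Measurable fun ω => gossipProd W s r ω i j := by
  induction r generalizing i j with
  | zero => simp only [gossipProd]; exact measurable_const
  | succ r ih =>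
    simp only [gossipProd, Matrix.mul_apply]
    exact Finset.measurable_sum _ fun l _ => (hW _ (by omega) (by omega) i l).mul
      (ih (fun k h1 h2 => hW k h1 (by omega)) l j)

theorem measurable_weightedAverage (π : ι ⊕ κ → ℝ) {x : Ω → ι ⊕ κ → EuclideanSpace ℝ (Fin d)}
    (hx : ∀ i, Measurable fun ω => x ω i) : Measurable fun ω => weightedAverage π (x ω) :=
  Finset.measurable_sum _ fun i _ => (hx i).const_smul (π i)

theorem measurable_add_vec {x y : Ω → EuclideanSpace ℝ (Fin d)} (hx : Measurable x)
    (hy : Measurable y) : Measurable fun ω => x ω + y ω := hx.add hy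

theorem measurable_sub_vec {x y : Ω → EuclideanSpace ℝ (Fin d)} (hx : Measurable x)
    (hy : Measurable y) : Measurable fun ω => x ω - y ω := hx.sub hy

theorem measurable_const_smul_sum (c c' : ℝ) {x : Ω → ι → EuclideanSpace ℝ (Fin d)}
    (hx : ∀ i, Measurable fun ω => x ω i) : Measurable fun ω => c • (c' • ∑ i, x ω i) :=
  ((Finset.measurable_sum _ fun i _ => hx i).const_smul c').const_smul c

theorem measurable_sub_smul {V : Type*} [Fintype V] {X Y : Ω → Stack V d} (hX : Measurable X)
    (hY : Measurable Y) (c : ℝ) : Measurable fun ω => X ω - c • Y ω :=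
  hX.sub (hY.const_smul c)

variable {W : ℕ → Ω → Matrix (ι ⊕ κ) (ι ⊕ κ) ℝ} {𝒟 : ι → Measure Ξ}
  {F : ι → EuclideanSpace ℝ (Fin d) → Ξ → ℝ} {L : ℝ} {π : ι ⊕ κ → ℝ} {ξ : ℕ → ι → Ω → Ξ}
  {η : ℝ} {xs x₀ : EuclideanSpace ℝ (Fin d)}

/-- The σ-algebra is left free, so that the lemma applies to the partial information `infoOn W ξ S`
on which independence arguments rest. -/
theorem ConvexCosts.measurable_iterate (hL : 0 ≤ L) (h : ConvexCosts 𝒟 F L xs) {k : ℕ}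
    (hW : ∀ l < k, ∀ i j, Measurable fun ω => W l ω i j)
    (hξ : ∀ l < k, ∀ n, Measurable (ξ l n)) (i : ι ⊕ κ) :
    Measurable fun ω => iterate W F π ξ η x₀ k ω i := by
  induction k generalizing i with
  | zero => simp only [iterate]; exact measurable_const
  | succ k ih =>
    have ih' := ih (fun l hl => hW l (by omega)) (fun l hl => hξ l (by omega))
    simp only [iterate]
    refine Finset.measurable_sum _ fun j _ => (hW k (by omega) i j).smul ?_
    rcases j with n | v
    · simp only [localStep]
      have hg : Measurable fun ω =>
          stochGrad F n (iterate W F π ξ η x₀ k ω (.inl n)) (ξ k n ω) :=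
        (h.measurable_uncurry_stochGrad hL n).comp ((ih' _).prodMk (hξ k (by omega) n))
      have hd := ((ih' (.inl n)).sub (hg.const_smul η)).sub (ih' (.inl n))
      exact (ih' _).add (hd.const_smul (1 / ((Fintype.card ι : ℝ) * π (.inl n))))
    · simp only [localStep]
      exact ih' _

end Measurability

/-! ### Recursions for the average and for the deviations from it -/

section Recursion

variable {ι κ : Type*} {d : ℕ}

/-- The stack that holds `g n` at the real nodes and `0` at the virtual ones. -/
def embed (κ : Type*) (g : ι → EuclideanSpace ℝ (Fin d)) : Stack (ι ⊕ κ) d :=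
  Stack.mk (Sum.elim g fun _ => 0)

@[simp] theorem embed_inl (g : ι → EuclideanSpace ℝ (Fin d)) (n : ι) :
    embed κ g (.inl n) = g n := rfl

@[simp] theorem embed_inr (g : ι → EuclideanSpace ℝ (Fin d)) (v : κ) :
    embed κ g (.inr v) = 0 := rfl

variable [Fintype ι] [Fintype κ]

theorem embed_add (g h : ι → EuclideanSpace ℝ (Fin d)) :
    embed κ (fun n => g n + h n) = embed κ g + embed κ h := by
  ext1 i
  rcases i with n | v <;> simp

theorem norm_embed_sq (g : ι → EuclideanSpace ℝ (Fin d)) :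
    ‖embed κ g‖ ^ 2 = ∑ n, ‖g n‖ ^ 2 := by
  rw [Stack.norm_sq_eq, Fintype.sum_sum_type]
  simp

theorem embed_eq_sum [DecidableEq ι] (g : ι → EuclideanSpace ℝ (Fin d)) :
    embed κ g = ∑ n, embed κ (Pi.single n (g n)) := by
  ext1 i
  rw [Stack.sum_apply]
  rcases i with n | v <;> simp [Finset.sum_pi_single]

theorem act_limitMatrix_apply (π : ι ⊕ κ → ℝ) (Z : Stack (ι ⊕ κ) d) (i : ι ⊕ κ) :
    act (limitMatrix π) Z i = weightedAverage π Z := rfl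

theorem act_averageMatrix_apply (Z : Stack (ι ⊕ κ) d) (i : ι ⊕ κ) :
    act (averageMatrix ι κ) Z i = (1 / (Fintype.card ι : ℝ)) • ∑ j, Z j := by
  simp [averageMatrix, Finset.smul_sum]

variable [DecidableEq ι] [DecidableEq κ]

theorem act_diagonal_apply (c : ι ⊕ κ → ℝ) (Z : Stack (ι ⊕ κ) d) (i : ι ⊕ κ) :
    act (Matrix.diagonal c) Z i = c i • Z i := by
  simp [Matrix.diagonal_apply]

/-- The purpose of the correction: `π_n` times `1/(N π_n)` is the uniform weight, whatever the
stationary weights are. -/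
theorem weightedAverage_correction {π : ι ⊕ κ → ℝ} (hπ : ∀ n : ι, 0 < π (.inl n))
    (g : ι → EuclideanSpace ℝ (Fin d)) :
    weightedAverage π (act (Matrix.diagonal (correction π)) (embed κ g))
      = (1 / (Fintype.card ι : ℝ)) • ∑ n, g n := by
  simp only [weightedAverage, act_diagonal_apply, Fintype.sum_sum_type, embed_inl, embed_inr,
    smul_zero, Finset.sum_const_zero, add_zero, correction, Finset.smul_sum, smul_smul]
  refine Finset.sum_congr rfl fun n _ => ?_
  have := (hπ n).ne'
  congr 1
  by_cases hN : (Fintype.card ι : ℝ) = 0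
  · simp [hN]
  · field_simp

theorem act_limitMatrix_correction {π : ι ⊕ κ → ℝ} (hπ : ∀ n : ι, 0 < π (.inl n))
    (g : ι → EuclideanSpace ℝ (Fin d)) :
    act (limitMatrix π) (act (Matrix.diagonal (correction π)) (embed κ g))
      = act (averageMatrix ι κ) (embed κ g) := by
  ext1 i
  rw [act_limitMatrix_apply, weightedAverage_correction hπ, act_averageMatrix_apply]
  simp [Fintype.sum_sum_type]

variable {Ω Ξ : Type*} (W : ℕ → Ω → Matrix (ι ⊕ κ) (ι ⊕ κ) ℝ)
  (F : ι → EuclideanSpace ℝ (Fin d) → Ξ → ℝ) (π : ι ⊕ κ → ℝ) (ξ : ℕ → ι → Ω → Ξ) (η : ℝ)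
  (x₀ : EuclideanSpace ℝ (Fin d))

/-- The stacked iterates. -/
def state (k : ℕ) (ω : Ω) : Stack (ι ⊕ κ) d := Stack.mk (iterate W F π ξ η x₀ k ω)

/-- The average `x̃^[k]`. -/
def avg (k : ℕ) (ω : Ω) : EuclideanSpace ℝ (Fin d) :=
  weightedAverage π (iterate W F π ξ η x₀ k ω)

/-- The deviations of the states from their average. -/
def dev (k : ℕ) (ω : Ω) : Stack (ι ⊕ κ) d :=
  state W F π ξ η x₀ k ω - act (limitMatrix π) (state W F π ξ η x₀ k ω)

/-- The stochastic gradients of round `k`. -/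
def grads (k : ℕ) (ω : Ω) (n : ι) : EuclideanSpace ℝ (Fin d) :=
  stochGrad F n (iterate W F π ξ η x₀ k ω (.inl n)) (ξ k n ω)

variable {W F π ξ η x₀}

theorem dev_apply (k : ℕ) (ω : Ω) (i : ι ⊕ κ) :
    dev W F π ξ η x₀ k ω i = iterate W F π ξ η x₀ k ω i - avg W F π ξ η x₀ k ω := rfl

/-- The virtual nodes carry the gradient `0`, so their diagonal entry plays no role. -/
theorem state_succ (k : ℕ) (ω : Ω) :
    state W F π ξ η x₀ (k + 1) ω = act (W k ω) (state W F π ξ η x₀ k ω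
      - η • act (Matrix.diagonal (correction π)) (embed κ (grads W F π ξ η x₀ k ω))) := by
  ext1 i
  simp only [state, act_apply, iterate]
  refine Finset.sum_congr rfl fun j _ => ?_
  congr 1
  rw [Stack.sub_apply, Stack.smul_apply, act_diagonal_apply]
  rcases j with n | v
  · simp only [localStep, embed_inl, correction, grads]
    rw [sub_sub_cancel_left, smul_neg, ← sub_eq_add_neg, smul_comm]
    rfl
  · simp [localStep]

/-- The pathwise content of the assumptions on the weights. -/
structure FixesLimit (W : ℕ → Ω → Matrix (ι ⊕ κ) (ι ⊕ κ) ℝ) (π : ι ⊕ κ → ℝ) (ω : Ω) :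
    Prop where
  mul_limit : ∀ k, W k ω * limitMatrix π = limitMatrix π
  limit_mul : ∀ k, limitMatrix π * W k ω = limitMatrix π
  sum_eq_one : ∑ i, π i = 1
  pos_real : ∀ n : ι, 0 < π (.inl n)

theorem GossipAssumption.ae_fixesLimit [MeasurableSpace Ω] {μ : Measure Ω} {p β : ℝ} {τ : ℕ}
    (h : GossipAssumption μ W π p τ β) : ∀ᵐ ω ∂μ, FixesLimit W π ω := by
  filter_upwards [ae_all_iff.2 h.mul_limit, ae_all_iff.2 h.limit_mul] with ω h1 h2
  exact ⟨h1, h2, h.sum_eq_one, h.pos_real⟩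

namespace FixesLimit

variable {ω : Ω}

/-- Column `n` of `W W^∞ = W^∞` says that each row sum of `W` times `π_n` is `π_n`. As `π_n > 0` at
a real node, the rows of `W` sum to one. -/
theorem mul_average [Nonempty ι] (h : FixesLimit W π ω) (k : ℕ) :
    W k ω * averageMatrix ι κ = averageMatrix ι κ := by
  obtain ⟨n⟩ := ‹Nonempty ι›
  ext i j
  have h1 := congrFun (congrFun (h.mul_limit k) i) (.inl n)
  simp only [Matrix.mul_apply, limitMatrix, averageMatrix, Matrix.of_apply,
    ← Finset.sum_mul] at h1 ⊢
  have : ∑ l, W k ω i l = 1 :=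
    mul_right_cancel₀ (h.pos_real n).ne' (h1.trans (one_mul _).symm)
  rw [this, one_mul]

theorem limit_mul_self (h : FixesLimit W π ω) : limitMatrix π * limitMatrix π = limitMatrix π := by
  ext i j
  simp [Matrix.mul_apply, limitMatrix, ← Finset.sum_mul, h.sum_eq_one]

theorem act_limit_dev (h : FixesLimit W π ω) (k : ℕ) :
    act (limitMatrix π) (dev W F π ξ η x₀ k ω) = 0 := by
  rw [dev, map_sub, ← act_mul, h.limit_mul_self, sub_self]

/-- The matrix `J` appears because `W^∞ D` and `J` agree on stacks supported on the real nodes. -/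
theorem dev_succ (h : FixesLimit W π ω) (k : ℕ) :
    dev W F π ξ η x₀ (k + 1) ω = act (W k ω) (dev W F π ξ η x₀ k ω)
      - η • act (W k ω * Matrix.diagonal (correction π) - averageMatrix ι κ)
        (embed κ (grads W F π ξ η x₀ k ω)) := by
  rw [dev, state_succ, ← act_mul, h.limit_mul, map_sub, map_sub, map_smul, map_smul,
    act_limitMatrix_correction h.pos_real, act_sub_matrix, act_mul, dev, map_sub,
    ← act_mul (W k ω) (limitMatrix π), h.mul_limit]
  module

/-- Unrolling `dev_succ`, with `W J = J` keeping the propagated matrices centred. The gradients of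
round `s + l` pass through `r - l ≥ 1` rounds, which for `r ≤ τ` is the range where the bound `β`
applies. -/
theorem dev_add [Nonempty ι] (h : FixesLimit W π ω) (s r : ℕ) :
    dev W F π ξ η x₀ (s + r) ω
      = act (gossipProd W s r ω - limitMatrix π) (dev W F π ξ η x₀ s ω)
        - η • ∑ l ∈ Finset.range r,
          act (gossipProd W (s + l) (r - l) ω * Matrix.diagonal (correction π)
            - averageMatrix ι κ) (embed κ (grads W F π ξ η x₀ (s + l) ω)) := by
  -- Subtracting `W^∞` is free, since it annihilates deviations; it is there for the contraction
  -- assumption.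
  rw [act_sub_matrix, h.act_limit_dev, sub_zero]
  induction r with
  | zero => simp [gossipProd, act_one]
  | succ r ih =>
    rw [← add_assoc, h.dev_succ, ih, Finset.sum_range_succ, map_sub, map_smul, map_sum,
      ← act_mul, smul_add, ← sub_sub]
    congr 1
    · congr 2
      refine Finset.sum_congr rfl fun l hl => ?_
      have hl' := Finset.mem_range.1 hl
      have e1 : r + 1 - l = (r - l) + 1 := by omega
      have e2 : s + l + (r - l) = s + r := by omega
      rw [e1, ← act_mul, gossipProd, e2, Matrix.mul_sub, h.mul_average, Matrix.mul_assoc]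
    · simp [gossipProd]

theorem avg_succ (h : FixesLimit W π ω) (k : ℕ) :
    avg W F π ξ η x₀ (k + 1) ω = avg W F π ξ η x₀ k ω
      - η • ((1 / (Fintype.card ι : ℝ)) • ∑ n, grads W F π ξ η x₀ k ω n) := by
  have hne : Nonempty (ι ⊕ κ) := by
    by_contra hc
    rw [not_nonempty_iff] at hc
    have := h.sum_eq_one
    simp at this
  obtain ⟨i⟩ := hne
  have e : ∀ k, avg W F π ξ η x₀ k ω = act (limitMatrix π) (state W F π ξ η x₀ k ω) i :=
    fun k => rfl
  rw [e, e, state_succ, ← act_mul, h.limit_mul, map_sub, map_smul, Stack.sub_apply,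
    Stack.smul_apply, act_limitMatrix_apply π (act _ _), weightedAverage_correction h.pos_real]

end FixesLimit

theorem avg_zero (hπ : ∑ i, π i = 1) (ω : Ω) : avg W F π ξ η x₀ 0 ω = x₀ := by
  simp [avg, weightedAverage, iterate, ← Finset.sum_smul, hπ]

theorem dev_zero (hπ : ∑ i, π i = 1) (ω : Ω) : dev W F π ξ η x₀ 0 ω = 0 := by
  ext1 i
  rw [dev_apply, avg_zero hπ]
  simp [iterate]

end Recursion

/-! ### Moments of the iterates -/

section Moments

variable {ι κ Ω Ξ : Type*} [Fintype ι] [DecidableEq ι] [Nonempty ι] [Fintype κ] [DecidableEq κ]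
  [mΩ : MeasurableSpace Ω] [MeasurableSpace Ξ] {d : ℕ} {μ : Measure Ω} [IsProbabilityMeasure μ]
  {𝒟 : ι → Measure Ξ} [∀ n, IsProbabilityMeasure (𝒟 n)]
  {F : ι → EuclideanSpace ℝ (Fin d) → Ξ → ℝ} {ξ : ℕ → ι → Ω → Ξ}
  {W : ℕ → Ω → Matrix (ι ⊕ κ) (ι ⊕ κ) ℝ} {π : ι ⊕ κ → ℝ}
  {p : ℝ} {τ : ℕ} {β L η : ℝ} {xs x₀ : EuclideanSpace ℝ (Fin d)}

/-- All assumptions together. -/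
structure Setting (μ : Measure Ω) (𝒟 : ι → Measure Ξ)
    (F : ι → EuclideanSpace ℝ (Fin d) → Ξ → ℝ) (ξ : ℕ → ι → Ω → Ξ)
    (W : ℕ → Ω → Matrix (ι ⊕ κ) (ι ⊕ κ) ℝ) (π : ι ⊕ κ → ℝ) (p : ℝ) (τ : ℕ) (β L : ℝ)
    (xs : EuclideanSpace ℝ (Fin d)) : Prop where
  random : RandomModel μ W 𝒟 ξ
  gossip : GossipAssumption μ W π p τ β
  costs : ConvexCosts 𝒟 F L xs
  L_nonneg : 0 ≤ L

/-- The gradients of the local objectives at the states of round `k`. -/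
def means (𝒟 : ι → Measure Ξ) (W : ℕ → Ω → Matrix (ι ⊕ κ) (ι ⊕ κ) ℝ)
    (F : ι → EuclideanSpace ℝ (Fin d) → Ξ → ℝ) (π : ι ⊕ κ → ℝ) (ξ : ℕ → ι → Ω → Ξ) (η : ℝ)
    (x₀ : EuclideanSpace ℝ (Fin d)) (k : ℕ) (ω : Ω) (n : ι) : EuclideanSpace ℝ (Fin d) :=
  gradient (localCost 𝒟 F n) (iterate W F π ξ η x₀ k ω (.inl n))

/-- The gradient noise of round `k`. -/
def noises (𝒟 : ι → Measure Ξ) (W : ℕ → Ω → Matrix (ι ⊕ κ) (ι ⊕ κ) ℝ)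
    (F : ι → EuclideanSpace ℝ (Fin d) → Ξ → ℝ) (π : ι ⊕ κ → ℝ) (ξ : ℕ → ι → Ω → Ξ) (η : ℝ)
    (x₀ : EuclideanSpace ℝ (Fin d)) (k : ℕ) (ω : Ω) (n : ι) : EuclideanSpace ℝ (Fin d) :=
  gradNoise 𝒟 F n (iterate W F π ξ η x₀ k ω (.inl n)) (ξ k n ω)

local notation "𝐱" => iterate W F π ξ η x₀
local notation "𝐚" => avg W F π ξ η x₀
local notation "𝐝" => dev W F π ξ η x₀
local notation "𝐦" => means 𝒟 W F π ξ η x₀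
local notation "𝐧" => noises 𝒟 W F π ξ η x₀

theorem grads_eq (k : ℕ) (ω : Ω) (n : ι) : grads W F π ξ η x₀ k ω n = 𝐦 k ω n + 𝐧 k ω n := by
  simp [grads, means, noises, gradNoise]

/-- The weight matrices from round `s` on. -/
def weightsFrom (ι : Type*) (s : ℕ) : Set (ℕ ⊕ ℕ × ι) := Sum.inl '' Set.Ici s

theorem inr_mem_weightsFrom_compl (s : ℕ) (q : ℕ × ι) :
    (.inr q : ℕ ⊕ ℕ × ι) ∈ (weightsFrom ι s)ᶜ := by
  simp [weightsFrom]

theorem inl_mem_weightsFrom_compl {s l : ℕ} (h : l < s) :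
    (.inl l : ℕ ⊕ ℕ × ι) ∈ (weightsFrom ι s)ᶜ := by
  simp [weightsFrom, h]

/-- The information in `S` determines what happens before round `k`. -/
structure Past (S : Set (ℕ ⊕ ℕ × ι)) (k : ℕ) : Prop where
  weight : ∀ l < k, .inl l ∈ S
  sample : ∀ l < k, ∀ n, .inr (l, n) ∈ S

theorem past_weightsFrom_compl {k s : ℕ} (h : k ≤ s) : Past (weightsFrom ι s)ᶜ k :=
  ⟨fun _ hl => inl_mem_weightsFrom_compl (hl.trans_le h),
    fun l _ n => inr_mem_weightsFrom_compl s (l, n)⟩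

theorem past_sample_compl {k l : ℕ} (h : k ≤ l) (n : ι) :
    Past ({.inr (l, n)}ᶜ : Set (ℕ ⊕ ℕ × ι)) k :=
  ⟨fun j _ => by simp, fun j hj m => by
    simp only [Set.mem_compl_iff, Set.mem_singleton_iff, Sum.inr.injEq, Prod.mk.injEq, not_and]
    omega⟩

theorem measurable_gossipProd_weightsFrom (s r : ℕ) (i j : ι ⊕ κ) :
    Measurable[infoOn W ξ (weightsFrom ι s)] fun ω => gossipProd W s r ω i j :=
  measurable_gossipProd (fun _ hk _ i j =>
    measurable_weight_infoOn (Set.mem_image_of_mem Sum.inl hk) i j) i j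

theorem measurable_gossipProd_sample_compl (s r l : ℕ) (n : ι) (i j : ι ⊕ κ) :
    Measurable[infoOn W ξ {.inr (l, n)}ᶜ] fun ω => gossipProd W s r ω i j :=
  measurable_gossipProd (fun _ _ _ i j => measurable_weight_infoOn (by simp) i j) i j

/-- The corrected products, centred at `J`. -/
def centred (W : ℕ → Ω → Matrix (ι ⊕ κ) (ι ⊕ κ) ℝ) (π : ι ⊕ κ → ℝ) (s r : ℕ) (ω : Ω) :
    Matrix (ι ⊕ κ) (ι ⊕ κ) ℝ :=
  gossipProd W s r ω * Matrix.diagonal (correction π) - averageMatrix ι κ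

theorem measurable_centred {m : MeasurableSpace Ω} {s r : ℕ}
    (h : ∀ i j, Measurable fun ω => gossipProd W s r ω i j) (i j : ι ⊕ κ) :
    Measurable fun ω => centred W π s r ω i j := by
  simp only [centred, Matrix.sub_apply, Matrix.mul_diagonal]
  exact ((h i j).mul_const _).sub_const _

namespace Setting

theorem measurable_iterate (h : Setting μ 𝒟 F ξ W π p τ β L xs) {S : Set (ℕ ⊕ ℕ × ι)} {k : ℕ}
    (hS : Past S k) (i : ι ⊕ κ) : Measurable[infoOn W ξ S] fun ω => 𝐱 k ω i :=
  h.costs.measurable_iterate h.L_nonneg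
    (fun l hl i j => measurable_weight_infoOn (hS.weight l hl) i j)
    (fun l hl n => measurable_sample_infoOn (hS.sample l hl n)) i

theorem measurable_avg (h : Setting μ 𝒟 F ξ W π p τ β L xs) {S : Set (ℕ ⊕ ℕ × ι)} {k : ℕ}
    (hS : Past S k) : Measurable[infoOn W ξ S] (𝐚 k) :=
  measurable_weightedAverage π fun i => h.measurable_iterate hS i

theorem measurable_dev (h : Setting μ 𝒟 F ξ W π p τ β L xs) {S : Set (ℕ ⊕ ℕ × ι)} {k : ℕ}
    (hS : Past S k) : Measurable[infoOn W ξ S] (𝐝 k) :=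
  Stack.measurable_mk (x := fun ω i => 𝐱 k ω i - 𝐚 k ω) fun i =>
    measurable_sub_vec (h.measurable_iterate hS i) (h.measurable_avg hS)

theorem measurable_means (h : Setting μ 𝒟 F ξ W π p τ β L xs) {S : Set (ℕ ⊕ ℕ × ι)} {k : ℕ}
    (hS : Past S k) (n : ι) : Measurable[infoOn W ξ S] fun ω => 𝐦 k ω n :=
  ((h.costs.smoothConvex_localCost h.L_nonneg n).continuous_grad h.L_nonneg).measurable.comp
    (h.measurable_iterate hS _)

theorem measurable_noises (h : Setting μ 𝒟 F ξ W π p τ β L xs) {S : Set (ℕ ⊕ ℕ × ι)} {k : ℕ}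
    (hS : Past S k) {n : ι} (hn : .inr (k, n) ∈ S) :
    Measurable[infoOn W ξ S] fun ω => 𝐧 k ω n :=
  (h.costs.measurable_gradNoise h.L_nonneg n).comp
    ((h.measurable_iterate hS _).prodMk (measurable_sample_infoOn hn))

end Setting

theorem measurable_embed {m : MeasurableSpace Ω} {g : Ω → ι → EuclideanSpace ℝ (Fin d)}
    (hg : ∀ n, Measurable fun ω => g ω n) : Measurable fun ω => embed κ (g ω) := by
  refine Stack.measurable_mk fun i => ?_
  rcases i with n | v
  · exact hg n
  · exact measurable_const

theorem memLp_embed {g : Ω → ι → EuclideanSpace ℝ (Fin d)}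
    (hg : ∀ n, MemLp (fun ω => g ω n) 2 μ) : MemLp (fun ω => embed κ (g ω)) 2 μ := by
  refine Stack.memLp_iff.2 fun i => ?_
  rcases i with n | v
  · exact hg n
  · exact MemLp.zero

theorem memLp_act_const (A : Matrix (ι ⊕ κ) (ι ⊕ κ) ℝ) {Z : Ω → Stack (ι ⊕ κ) d}
    (hZ : MemLp Z 2 μ) : MemLp (fun ω => act A (Z ω)) 2 μ :=
  hZ.of_le_mul ((AddMonoidHomClass.continuous_of_bound (act A) (specNorm A)
    (norm_act_le A)).comp_aestronglyMeasurable hZ.1)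
    (Filter.Eventually.of_forall fun ω => norm_act_le A (Z ω))

namespace Setting

theorem weight_indep (h : Setting μ 𝒟 F ξ W π p τ β L xs) (s : ℕ) :
    Indep (infoOn W ξ (weightsFrom ι s)) (infoOn W ξ (weightsFrom ι s)ᶜ) μ :=
  h.random.indep_infoOn disjoint_compl_right

/-- A centred product acting on a stack that depends only on the past and the samples. -/
theorem memLp_centred_act (h : Setting μ 𝒟 F ξ W π p τ β L xs) {s r : ℕ} (h1 : 1 ≤ r)
    (hr : r ≤ τ) {Z : Ω → Stack (ι ⊕ κ) d} (hZ : Measurable[infoOn W ξ (weightsFrom ι s)ᶜ] Z)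
    (hZ2 : MemLp Z 2 μ) :
    MemLp (fun ω => act (centred W π s r ω) (Z ω)) 2 μ ∧
      ∫ ω, ‖act (centred W π s r ω) (Z ω)‖ ^ 2 ∂μ ≤ β ^ 2 * ∫ ω, ‖Z ω‖ ^ 2 ∂μ := by
  have hb := h.gossip.bounded s r h1 hr
  have key := memLp_act_of_indep (h.random.infoOn_le _) (h.random.infoOn_le _)
    (h.weight_indep s) (A := centred W π s r)
    (measurable_centred (measurable_gossipProd_weightsFrom s r)) hZ hb.1 hZ2
  exact ⟨key.1, key.2.trans
    (mul_le_mul_of_nonneg_right hb.2 (integral_nonneg fun ω => by positivity))⟩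

theorem memLp_means_of (h : Setting μ 𝒟 F ξ W π p τ β L xs) {k : ℕ}
    (hx : ∀ i, MemLp (fun ω => 𝐱 k ω i) 2 μ) (n : ι) : MemLp (fun ω => 𝐦 k ω n) 2 μ := by
  have hs := h.costs.smoothConvex_localCost h.L_nonneg n
  have h1 : MemLp (fun ω => 𝐦 k ω n - gradient (localCost 𝒟 F n) xs) 2 μ := by
    refine ((hx (.inl n)).sub (memLp_const xs)).of_le_mul (c := L) ?_
      (Filter.Eventually.of_forall fun ω => hs.lipschitz h.L_nonneg _ _)
    exact ((hs.continuous_grad h.L_nonneg).comp_aestronglyMeasurable (hx (.inl n)).1).sub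
      aestronglyMeasurable_const
  refine (h1.add (memLp_const (gradient (localCost 𝒟 F n) xs))).ae_eq
    (Filter.Eventually.of_forall fun ω => ?_)
  simp

theorem memLp_noises_of (h : Setting μ 𝒟 F ξ W π p τ β L xs) {k : ℕ}
    (hx : ∀ i, MemLp (fun ω => 𝐱 k ω i) 2 μ) (n : ι) : MemLp (fun ω => 𝐧 k ω n) 2 μ := by
  have hp : Past ({.inr (k, n)}ᶜ : Set (ℕ ⊕ ℕ × ι)) k := past_sample_compl le_rfl n
  refine (h.costs.integral_gradNoise_comp_sq_le h.L_nonneg (h.random.infoOn_le _)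
    (h.random.measurable_sample k n) (h.random.law k n) (h.random.indep_sample_infoOn k n)
    (h.measurable_iterate hp (.inl n)) (y := fun _ => xs) measurable_const ?_).1
  exact ((((hx (.inl n)).sub (memLp_const xs)).integrable_norm_sq.const_mul _).add
    (integrable_const _)).add (integrable_const _)

/-- No moment of a single `W` is assumed directly. The state update is therefore written as `(W D -
J) Z + J Z`, where the first matrix has a second moment by the assumption with `r = 1` and is
independent of `Z`. -/
theorem memLp_iterate (h : Setting μ 𝒟 F ξ W π p τ β L xs) (k : ℕ) (i : ι ⊕ κ) :
    MemLp (fun ω => 𝐱 k ω i) 2 μ := by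
  induction k generalizing i with
  | zero => exact memLp_const x₀
  | succ k ih =>
    have hN : (0 : ℝ) < Fintype.card ι := by exact_mod_cast Fintype.card_pos
    have hcpos : ∀ i, correction π i ≠ 0 := by
      intro i
      rcases i with n | v
      · have := h.gossip.pos_real n
        simp only [correction]
        positivity
      · simp [correction]
    -- `Z` is `D⁻¹` applied to the corrected local states, so that `W D Z` is the next state; `D` is
    -- invertible because `π` is positive at real nodes.
    obtain ⟨Z, hZ⟩ : ∃ Z : Ω → Stack (ι ⊕ κ) d, Z = fun ω =>
      act (Matrix.diagonal fun i => (correction π i)⁻¹) (state W F π ξ η x₀ k ω)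
        - η • embed κ (grads W F π ξ η x₀ k ω) := ⟨_, rfl⟩
    have hZeq : ∀ ω, act (Matrix.diagonal (correction π)) (Z ω) = state W F π ξ η x₀ k ω
        - η • act (Matrix.diagonal (correction π)) (embed κ (grads W F π ξ η x₀ k ω)) := by
      intro ω
      rw [hZ, map_sub, map_smul, ← act_mul, Matrix.diagonal_mul_diagonal]
      congr 1
      have : (fun i => correction π i * (correction π i)⁻¹) = fun _ => 1 := by
        ext i; exact mul_inv_cancel₀ (hcpos i)
      rw [this, Matrix.diagonal_one, act_one]
    have hZ2 : MemLp Z 2 μ := by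
      rw [hZ]
      refine (memLp_act_const _ (Stack.memLp_iff.2 ih)).sub ((memLp_embed fun n => ?_).const_smul η)
      simp_rw [grads_eq (𝒟 := 𝒟)]
      exact (h.memLp_means_of ih n).add (h.memLp_noises_of ih n)
    have hp : Past (weightsFrom ι k)ᶜ k := past_weightsFrom_compl le_rfl
    have hZm : Measurable[infoOn W ξ (weightsFrom ι k)ᶜ] Z := by
      have h1 : Measurable[infoOn W ξ (weightsFrom ι k)ᶜ] fun ω => state W F π ξ η x₀ k ω :=
        Stack.measurable_mk fun i => h.measurable_iterate hp i
      have h2 : Measurable[infoOn W ξ (weightsFrom ι k)ᶜ] fun ω =>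
          embed κ (grads W F π ξ η x₀ k ω) := by
        refine measurable_embed fun n => ?_
        simp_rw [grads_eq (𝒟 := 𝒟)]
        exact measurable_add_vec (h.measurable_means hp n)
          (h.measurable_noises hp (inr_mem_weightsFrom_compl k (k, n)))
      rw [hZ]
      exact measurable_sub_smul (measurable_act
        (A := fun _ => Matrix.diagonal fun i => (correction π i)⁻¹)
        (fun _ _ => measurable_const) h1) h2 η
    have h1 := (h.memLp_centred_act (s := k) le_rfl h.gossip.one_le_tau hZm hZ2).1
    have h2 := h1.add (memLp_act_const (averageMatrix ι κ) hZ2)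
    have h3 : MemLp (state W F π ξ η x₀ (k + 1)) 2 μ := by
      refine h2.ae_eq (Filter.Eventually.of_forall fun ω => ?_)
      simp only [Pi.add_apply, centred]
      rw [act_sub_matrix, sub_add_cancel, act_mul, hZeq, state_succ]
      simp [gossipProd]
    exact Stack.memLp_iff.1 h3 i

theorem memLp_means (h : Setting μ 𝒟 F ξ W π p τ β L xs) (k : ℕ) (n : ι) :
    MemLp (fun ω => 𝐦 k ω n) 2 μ := h.memLp_means_of (h.memLp_iterate k) n

theorem memLp_noises (h : Setting μ 𝒟 F ξ W π p τ β L xs) (k : ℕ) (n : ι) :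
    MemLp (fun ω => 𝐧 k ω n) 2 μ := h.memLp_noises_of (h.memLp_iterate k) n

theorem memLp_avg (h : Setting μ 𝒟 F ξ W π p τ β L xs) (k : ℕ) : MemLp (𝐚 k) 2 μ :=
  memLp_finsetSum _ fun i _ => (h.memLp_iterate k i).const_smul (π i)

theorem memLp_dev (h : Setting μ 𝒟 F ξ W π p τ β L xs) (k : ℕ) : MemLp (𝐝 k) 2 μ :=
  Stack.memLp_iff.2 fun i => show MemLp (fun ω => 𝐱 k ω i - 𝐚 k ω) 2 μ from
    (h.memLp_iterate k i).sub (h.memLp_avg k)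

/-- The Bregman divergences of the objectives at the averages are integrable. -/
theorem integrable_bregman (h : Setting μ 𝒟 F ξ W π p τ β L xs) (k : ℕ) (n : ι) :
    Integrable (fun ω => bregman (localCost 𝒟 F n) (gradient (localCost 𝒟 F n)) (𝐚 k ω) xs) μ := by
  have hs := h.costs.smoothConvex_localCost h.L_nonneg n
  refine (((h.memLp_avg (η := η) (x₀ := x₀) k).sub
    (memLp_const xs)).integrable_norm_sq.const_mul (L / 2)).mono' ?_
    (Filter.Eventually.of_forall fun ω => ?_)
  · have hc := hs.continuous
    have : Continuous fun x => bregman (localCost 𝒟 F n) (gradient (localCost 𝒟 F n)) x xs := by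
      unfold bregman
      fun_prop
    exact this.comp_aestronglyMeasurable (h.memLp_avg k).1
  · rw [Real.norm_eq_abs, abs_of_nonneg (hs.bregman_nonneg _ _)]
    exact hs.bregman_le _ _

theorem integrable_globalCost (h : Setting μ 𝒟 F ξ W π p τ β L xs) (k : ℕ) :
    Integrable (fun ω => globalCost 𝒟 F (𝐚 k ω)) μ := by
  have hN : (0 : ℝ) < Fintype.card ι := by exact_mod_cast Fintype.card_pos
  have h1 := (integrable_finsetSum Finset.univ fun n _ => h.integrable_bregman (η := η) (x₀ := x₀)
    k n).const_mul (1 / (Fintype.card ι : ℝ))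
  simp_rw [h.costs.sum_bregman h.L_nonneg] at h1
  refine (h1.add (integrable_const (globalCost 𝒟 F xs))).congr
    (Filter.Eventually.of_forall fun ω => ?_)
  simp only [Pi.add_apply]
  field_simp
  ring

end Setting

end Moments

/-! ### One-block and one-step estimates -/

section Estimates

variable {ι κ Ω Ξ : Type*} [Fintype ι] [DecidableEq ι] [Nonempty ι] [Fintype κ] [DecidableEq κ]
  [mΩ : MeasurableSpace Ω] [MeasurableSpace Ξ] {d : ℕ} {μ : Measure Ω} [IsProbabilityMeasure μ]
  {𝒟 : ι → Measure Ξ} [∀ n, IsProbabilityMeasure (𝒟 n)]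
  {F : ι → EuclideanSpace ℝ (Fin d) → Ξ → ℝ} {ξ : ℕ → ι → Ω → Ξ}
  {W : ℕ → Ω → Matrix (ι ⊕ κ) (ι ⊕ κ) ℝ} {π : ι ⊕ κ → ℝ}
  {p : ℝ} {τ : ℕ} {β L η : ℝ} {xs x₀ : EuclideanSpace ℝ (Fin d)}

local notation "𝐱" => iterate W F π ξ η x₀
local notation "𝐚" => avg W F π ξ η x₀
local notation "𝐝" => dev W F π ξ η x₀
local notation "𝐦" => means 𝒟 W F π ξ η x₀
local notation "𝐧" => noises 𝒟 W F π ξ η x₀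

theorem sum_dev_sq_le (k : ℕ) (ω : Ω) :
    ∑ n, ‖𝐱 k ω (.inl n) - 𝐚 k ω‖ ^ 2 ≤ ‖𝐝 k ω‖ ^ 2 := by
  rw [Stack.norm_sq_eq, Fintype.sum_sum_type]
  simp_rw [dev_apply]
  have : 0 ≤ ∑ v : κ, ‖𝐱 k ω (.inr v) - 𝐚 k ω‖ ^ 2 := Finset.sum_nonneg fun _ _ => by positivity
  linarith

theorem heterogeneity_sq (𝒟 : ι → Measure Ξ) (F : ι → EuclideanSpace ℝ (Fin d) → Ξ → ℝ)
    (xs : EuclideanSpace ℝ (Fin d)) :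
    Fintype.card ι * heterogeneity 𝒟 F xs ^ 2 = ∑ n, ‖gradient (localCost 𝒟 F n) xs‖ ^ 2 := by
  have hN : (0 : ℝ) < Fintype.card ι := by exact_mod_cast Fintype.card_pos
  rw [heterogeneity, Real.sq_sqrt (by positivity)]
  field_simp

theorem noiseLevel_sq (𝒟 : ι → Measure Ξ) (F : ι → EuclideanSpace ℝ (Fin d) → Ξ → ℝ)
    (xs : EuclideanSpace ℝ (Fin d)) :
    Fintype.card ι * noiseLevel 𝒟 F xs ^ 2 = ∑ n, noiseSq 𝒟 F xs n := by
  have hN : (0 : ℝ) < Fintype.card ι := by exact_mod_cast Fintype.card_pos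
  have h0 : ∀ n, 0 ≤ noiseSq 𝒟 F xs n := fun n => integral_nonneg fun z => by positivity
  have h1 : 0 ≤ ∑ n, noiseSq 𝒟 F xs n := Finset.sum_nonneg fun n _ => h0 n
  rw [noiseLevel, Real.sq_sqrt (by positivity)]
  field_simp

namespace Setting

theorem memLp_embed_means (h : Setting μ 𝒟 F ξ W π p τ β L xs) (k : ℕ) :
    MemLp (fun ω => embed κ (𝐦 k ω)) 2 μ := memLp_embed fun n => h.memLp_means k n

theorem memLp_embed_noises (h : Setting μ 𝒟 F ξ W π p τ β L xs) (k : ℕ) :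
    MemLp (fun ω => embed κ (𝐧 k ω)) 2 μ := memLp_embed fun n => h.memLp_noises k n

/-- The integrated form of the local bounds on gradients and noise. -/
theorem integral_sum_local_bound (h : Setting μ 𝒟 F ξ W π p τ β L xs) (k : ℕ) (c : ι → ℝ) :
    Integrable (fun ω => ∑ n, (3 * L ^ 2 * ‖𝐱 k ω (.inl n) - 𝐚 k ω‖ ^ 2
      + 6 * L * bregman (localCost 𝒟 F n) (gradient (localCost 𝒟 F n)) (𝐚 k ω) xs
      + 3 * c n)) μ ∧
    ∫ ω, ∑ n, (3 * L ^ 2 * ‖𝐱 k ω (.inl n) - 𝐚 k ω‖ ^ 2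
      + 6 * L * bregman (localCost 𝒟 F n) (gradient (localCost 𝒟 F n)) (𝐚 k ω) xs
      + 3 * c n) ∂μ
    ≤ 3 * L ^ 2 * ∫ ω, ‖𝐝 k ω‖ ^ 2 ∂μ
      + 6 * L * (Fintype.card ι * ∫ ω, (globalCost 𝒟 F (𝐚 k ω) - globalCost 𝒟 F xs) ∂μ)
      + 3 * ∑ n, c n := by
  have i1 : Integrable (fun ω => ∑ n, (3 * L ^ 2 * ‖𝐱 k ω (.inl n) - 𝐚 k ω‖ ^ 2
      + 6 * L * bregman (localCost 𝒟 F n) (gradient (localCost 𝒟 F n)) (𝐚 k ω) xs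
      + 3 * c n)) μ :=
    integrable_finsetSum _ fun n _ =>
      ((((h.memLp_iterate k (.inl n)).sub (h.memLp_avg k)).integrable_norm_sq.const_mul _).add
        ((h.integrable_bregman k n).const_mul _)).add (integrable_const _)
  have i2 := (h.memLp_dev (η := η) (x₀ := x₀) k).integrable_norm_sq.const_mul (3 * L ^ 2)
  have i3 : Integrable (fun ω => 6 * L * (Fintype.card ι *
      (globalCost 𝒟 F (𝐚 k ω) - globalCost 𝒟 F xs))) μ :=
    (((h.integrable_globalCost k).sub (integrable_const _)).const_mul _).const_mul _
  refine ⟨i1, ?_⟩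
  have hle := integral_mono i1 ((i2.add i3).add (integrable_const (3 * ∑ n, c n))) fun ω => by
    simp only [Pi.add_apply]
    rw [Finset.sum_add_distrib, Finset.sum_add_distrib, ← Finset.mul_sum, ← Finset.mul_sum,
      ← Finset.mul_sum, h.costs.sum_bregman h.L_nonneg]
    have := sum_dev_sq_le (W := W) (F := F) (π := π) (ξ := ξ) (η := η) (x₀ := x₀) k ω
    have hL := sq_nonneg L
    gcongr
  refine hle.trans_eq ?_
  simp only [Pi.add_apply]
  rw [integral_add₃ i2 i3 (integrable_const _), integral_const_mul, integral_const_mul,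
    integral_const_mul]
  simp

theorem integral_means_sq_le (h : Setting μ 𝒟 F ξ W π p τ β L xs) (k : ℕ) :
    ∫ ω, ‖embed κ (𝐦 k ω)‖ ^ 2 ∂μ ≤ 3 * L ^ 2 * ∫ ω, ‖𝐝 k ω‖ ^ 2 ∂μ
      + 6 * L * (Fintype.card ι * ∫ ω, (globalCost 𝒟 F (𝐚 k ω) - globalCost 𝒟 F xs) ∂μ)
      + 3 * (Fintype.card ι * heterogeneity 𝒟 F xs ^ 2) := by
  have key := h.integral_sum_local_bound (η := η) (x₀ := x₀) k
    fun n => ‖gradient (localCost 𝒟 F n) xs‖ ^ 2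
  rw [heterogeneity_sq]
  refine (integral_mono (h.memLp_embed_means k).integrable_norm_sq key.1 fun ω => ?_).trans key.2
  simp only [norm_embed_sq]
  exact Finset.sum_le_sum fun n _ => h.costs.gradient_sq_le h.L_nonneg n _ _

theorem integral_norm_embed_sq {g : Ω → ι → EuclideanSpace ℝ (Fin d)}
    (hg : ∀ n, MemLp (fun ω => g ω n) 2 μ) :
    ∫ ω, ‖embed κ (g ω)‖ ^ 2 ∂μ = ∑ n, ∫ ω, ‖g ω n‖ ^ 2 ∂μ := by
  simp_rw [norm_embed_sq]
  exact integral_finsetSum _ fun n _ => (hg n).integrable_norm_sq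

/-- The bound is taken node by node, each time freezing everything except the one sample `ξ k n`;
the average of round `k` does not depend on it and may serve as reference point. -/
theorem integral_noises_sq_le (h : Setting μ 𝒟 F ξ W π p τ β L xs) (k : ℕ) :
    ∫ ω, ‖embed κ (𝐧 k ω)‖ ^ 2 ∂μ ≤ 3 * L ^ 2 * ∫ ω, ‖𝐝 k ω‖ ^ 2 ∂μ
      + 6 * L * (Fintype.card ι * ∫ ω, (globalCost 𝒟 F (𝐚 k ω) - globalCost 𝒟 F xs) ∂μ)
      + 3 * (Fintype.card ι * noiseLevel 𝒟 F xs ^ 2) := by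
  have key := h.integral_sum_local_bound (η := η) (x₀ := x₀) k fun n => noiseSq 𝒟 F xs n
  have hi : ∀ n, Integrable (fun ω => 3 * L ^ 2 * ‖𝐱 k ω (.inl n) - 𝐚 k ω‖ ^ 2
      + 6 * L * bregman (localCost 𝒟 F n) (gradient (localCost 𝒟 F n)) (𝐚 k ω) xs
      + 3 * noiseSq 𝒟 F xs n) μ := fun n =>
    ((((h.memLp_iterate k (.inl n)).sub (h.memLp_avg k)).integrable_norm_sq.const_mul _).add
      ((h.integrable_bregman k n).const_mul _)).add (integrable_const _)
  rw [noiseLevel_sq, integral_norm_embed_sq fun n => h.memLp_noises k n]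
  rw [integral_finsetSum _ fun n _ => hi n] at key
  refine le_trans (Finset.sum_le_sum fun n _ => ?_) key.2
  have hp : Past ({.inr (k, n)}ᶜ : Set (ℕ ⊕ ℕ × ι)) k := past_sample_compl le_rfl n
  exact (h.costs.integral_gradNoise_comp_sq_le h.L_nonneg (h.random.infoOn_le _)
    (h.random.measurable_sample k n) (h.random.law k n) (h.random.indep_sample_infoOn k n)
    (h.measurable_iterate hp (.inl n)) (h.measurable_avg hp) (hi n)).2

/-- The noise of a single node and round is orthogonal to whatever does not depend on the sample
of that node and round. -/
theorem integral_inner_noises (h : Setting μ 𝒟 F ξ W π p τ β L xs) (k : ℕ) (n : ι)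
    {Z : Ω → EuclideanSpace ℝ (Fin d)} (hZ : Measurable[infoOn W ξ {.inr (k, n)}ᶜ] Z)
    (hi : Integrable (fun ω => inner ℝ (Z ω) (𝐧 k ω n)) μ) :
    ∫ ω, inner ℝ (Z ω) (𝐧 k ω n) ∂μ = 0 :=
  h.costs.integral_inner_gradNoise h.L_nonneg (h.random.infoOn_le _)
    (h.random.measurable_sample k n) (h.random.law k n) (h.random.indep_sample_infoOn k n)
    (h.measurable_iterate (past_sample_compl le_rfl n) (.inl n)) hZ hi

/-- Transposition moves the matrix onto `Z`, which isolates the noise of one node from all that is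
independent of it. -/
theorem inner_act_single (A : Matrix (ι ⊕ κ) (ι ⊕ κ) ℝ) (Z : Stack (ι ⊕ κ) d) (n : ι)
    (g : EuclideanSpace ℝ (Fin d)) :
    inner ℝ Z (act A (embed κ (Pi.single n g))) = inner ℝ (act A.transpose Z (.inl n)) g := by
  simp only [Stack.inner_eq, act_apply, Fintype.sum_sum_type (α₁ := ι), embed_inl, embed_inr,
    smul_zero, Finset.sum_const_zero, add_zero, inner_add_left, sum_inner, Matrix.transpose_apply,
    inner_smul_left, inner_smul_right, Pi.single_apply, smul_ite, Finset.sum_ite_eq',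
    Finset.mem_univ, if_true]
  simp

/-- The propagated noise of round `k` is orthogonal to whatever does not depend on the samples of
that round. -/
theorem integral_inner_act_noises (h : Setting μ 𝒟 F ξ W π p τ β L xs) {k r : ℕ} (h1 : 1 ≤ r)
    (hr : r ≤ τ) {Z : Ω → Stack (ι ⊕ κ) d}
    (hZ : ∀ n, Measurable[infoOn W ξ {.inr (k, n)}ᶜ] Z) (hZ2 : MemLp Z 2 μ) :
    ∫ ω, inner ℝ (Z ω) (act (centred W π k r ω) (embed κ (𝐧 k ω))) ∂μ = 0 := by
  have e : ∀ ω, inner ℝ (Z ω) (act (centred W π k r ω) (embed κ (𝐧 k ω)))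
      = ∑ n, inner ℝ (Z ω) (act (centred W π k r ω) (embed κ (Pi.single n (𝐧 k ω n)))) := by
    intro ω
    rw [embed_eq_sum, map_sum, inner_sum]
  have hp : Past (weightsFrom ι k)ᶜ k := past_weightsFrom_compl le_rfl
  have hmem : ∀ n, MemLp (fun ω => act (centred W π k r ω)
      (embed κ (Pi.single n (𝐧 k ω n)))) 2 μ := by
    intro n
    refine (h.memLp_centred_act h1 hr (measurable_embed fun m => ?_)
      (memLp_embed fun m => ?_)).1
    · by_cases hm : m = n
      · subst hm
        simp only [Pi.single_eq_same]
        exact h.measurable_noises hp (inr_mem_weightsFrom_compl _ _)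
      · simp only [Pi.single_eq_of_ne hm]
        exact measurable_const
    · by_cases hm : m = n
      · subst hm
        simp only [Pi.single_eq_same]
        exact h.memLp_noises k m
      · simp only [Pi.single_eq_of_ne hm]
        exact MemLp.zero
  simp_rw [e]
  rw [integral_finsetSum _ fun n _ => hZ2.integrable_inner_two (hmem n)]
  refine Finset.sum_eq_zero fun n _ => ?_
  have hi := hZ2.integrable_inner_two (hmem n)
  simp_rw [inner_act_single] at hi ⊢
  refine h.integral_inner_noises k n (Stack.measurable_eval (measurable_act
    (A := fun ω => (centred W π k r ω).transpose) (fun i j => ?_) (hZ n)) _) hi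
  exact measurable_centred (measurable_gossipProd_sample_compl k r k n) j i

end Setting

end Estimates

/-! ### The deviations over a block of rounds -/

section Block

variable {ι κ Ω Ξ : Type*} [Fintype ι] [DecidableEq ι] [Nonempty ι] [Fintype κ] [DecidableEq κ]
  [mΩ : MeasurableSpace Ω] [MeasurableSpace Ξ] {d : ℕ} {μ : Measure Ω} [IsProbabilityMeasure μ]
  {𝒟 : ι → Measure Ξ} [∀ n, IsProbabilityMeasure (𝒟 n)]
  {F : ι → EuclideanSpace ℝ (Fin d) → Ξ → ℝ} {ξ : ℕ → ι → Ω → Ξ}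
  {W : ℕ → Ω → Matrix (ι ⊕ κ) (ι ⊕ κ) ℝ} {π : ι ⊕ κ → ℝ}
  {p : ℝ} {τ : ℕ} {β L η : ℝ} {xs x₀ : EuclideanSpace ℝ (Fin d)}

local notation "𝐱" => iterate W F π ξ η x₀
local notation "𝐚" => avg W F π ξ η x₀
local notation "𝐝" => dev W F π ξ η x₀
local notation "𝐦" => means 𝒟 W F π ξ η x₀
local notation "𝐧" => noises 𝒟 W F π ξ η x₀

theorem norm_sum_sq_le {α E : Type*} [SeminormedAddCommGroup E] (s : Finset α) (f : α → E) :
    ‖∑ a ∈ s, f a‖ ^ 2 ≤ s.card * ∑ a ∈ s, ‖f a‖ ^ 2 :=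
  (pow_le_pow_left₀ (norm_nonneg _) (norm_sum_le s f) 2).trans sq_sum_le_card_mul_sum_sq

/-- Young's inequality, leaving the product of `b` and `n` as it is. -/
theorem norm_sub_smul_add_sq_le {E : Type*} [NormedAddCommGroup E] [InnerProductSpace ℝ E]
    (b m n : E) (c : ℝ) {p : ℝ} (hp : 0 < p) (hp1 : p ≤ 1) :
    ‖b - c • (m + n)‖ ^ 2 ≤ (1 + p / 2) * ‖b‖ ^ 2 + 4 / p * c ^ 2 * ‖m‖ ^ 2
      + (2 * c ^ 2 * ‖n‖ ^ 2 - 2 * c * inner ℝ b n) := by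
  have e : ‖b - c • (m + n)‖ ^ 2 = ‖b‖ ^ 2 - 2 * c * inner ℝ b m - 2 * c * inner ℝ b n
      + c ^ 2 * ‖m + n‖ ^ 2 := by
    rw [norm_sub_sq_real, inner_smul_right, inner_add_right, norm_smul, mul_pow,
      Real.norm_eq_abs, sq_abs]
    ring
  have h1 : ‖m + n‖ ^ 2 ≤ 2 * ‖m‖ ^ 2 + 2 * ‖n‖ ^ 2 := by
    have := norm_add_le m n
    nlinarith [sq_nonneg (‖m‖ - ‖n‖), norm_nonneg (m + n)]
  -- The left-over terms are `2/p` times the square of `(p/2) b + c m`.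
  have h2 : 0 ≤ p / 2 * ‖b‖ ^ 2 + 2 * c * inner ℝ b m + 2 / p * c ^ 2 * ‖m‖ ^ 2 := by
    have h3 : 0 ≤ ‖(p / 2) • b + c • m‖ ^ 2 := by positivity
    rw [norm_add_sq_real, inner_smul_left, inner_smul_right, norm_smul, norm_smul, mul_pow,
      mul_pow, Real.norm_eq_abs, Real.norm_eq_abs, sq_abs, sq_abs] at h3
    have h4 : p / 2 * ‖b‖ ^ 2 + 2 * c * inner ℝ b m + 2 / p * c ^ 2 * ‖m‖ ^ 2
        = 2 / p * ((p / 2) ^ 2 * ‖b‖ ^ 2 + 2 * (p / 2 * (c * inner ℝ b m))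
          + c ^ 2 * ‖m‖ ^ 2) := by
      field_simp
    rw [h4]
    exact mul_nonneg (by positivity) h3
  have h5 : 2 * c ^ 2 * ‖m‖ ^ 2 ≤ 2 / p * c ^ 2 * ‖m‖ ^ 2 := by
    have : 2 ≤ 2 / p := by rw [le_div_iff₀ hp]; linarith
    gcongr
  have h6 : 4 / p * c ^ 2 * ‖m‖ ^ 2 = 2 / p * c ^ 2 * ‖m‖ ^ 2 + 2 / p * c ^ 2 * ‖m‖ ^ 2 := by
    ring
  rw [e, h6]
  nlinarith [mul_le_mul_of_nonneg_left h1 (sq_nonneg c)]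

namespace Setting

theorem memLp_act_means (h : Setting μ 𝒟 F ξ W π p τ β L xs) {k r : ℕ} (h1 : 1 ≤ r)
    (hr : r ≤ τ) :
    MemLp (fun ω => act (centred W π k r ω) (embed κ (𝐦 k ω))) 2 μ ∧
      ∫ ω, ‖act (centred W π k r ω) (embed κ (𝐦 k ω))‖ ^ 2 ∂μ
        ≤ β ^ 2 * ∫ ω, ‖embed κ (𝐦 k ω)‖ ^ 2 ∂μ :=
  h.memLp_centred_act h1 hr (measurable_embed fun n =>
    h.measurable_means (past_weightsFrom_compl le_rfl) n) (h.memLp_embed_means k)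

theorem memLp_act_noises (h : Setting μ 𝒟 F ξ W π p τ β L xs) {k r : ℕ} (h1 : 1 ≤ r)
    (hr : r ≤ τ) :
    MemLp (fun ω => act (centred W π k r ω) (embed κ (𝐧 k ω))) 2 μ ∧
      ∫ ω, ‖act (centred W π k r ω) (embed κ (𝐧 k ω))‖ ^ 2 ∂μ
        ≤ β ^ 2 * ∫ ω, ‖embed κ (𝐧 k ω)‖ ^ 2 ∂μ :=
  h.memLp_centred_act h1 hr (measurable_embed fun _ =>
    h.measurable_noises (past_weightsFrom_compl le_rfl) (inr_mem_weightsFrom_compl _ _))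
    (h.memLp_embed_noises k)

theorem memLp_sum_means (h : Setting μ 𝒟 F ξ W π p τ β L xs) (s : ℕ) {r : ℕ} (hr : r ≤ τ) :
    MemLp (fun ω => ∑ l ∈ Finset.range r,
      act (centred W π (s + l) (r - l) ω) (embed κ (𝐦 (s + l) ω))) 2 μ ∧
    ∫ ω, ‖∑ l ∈ Finset.range r,
      act (centred W π (s + l) (r - l) ω) (embed κ (𝐦 (s + l) ω))‖ ^ 2 ∂μ
      ≤ τ * β ^ 2 * ∑ l ∈ Finset.range r, ∫ ω, ‖embed κ (𝐦 (s + l) ω)‖ ^ 2 ∂μ := by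
  have hm : ∀ l ∈ Finset.range r, _ := fun l hl =>
    h.memLp_act_means (η := η) (x₀ := x₀) (k := s + l) (r := r - l)
      (by have := Finset.mem_range.1 hl; omega) (by omega)
  have h1 : MemLp (fun ω => ∑ l ∈ Finset.range r,
      act (centred W π (s + l) (r - l) ω) (embed κ (𝐦 (s + l) ω))) 2 μ :=
    memLp_finsetSum _ fun l hl => (hm l hl).1
  refine ⟨h1, ?_⟩
  have i1 : Integrable (fun ω => ∑ l ∈ Finset.range r,
      ‖act (centred W π (s + l) (r - l) ω) (embed κ (𝐦 (s + l) ω))‖ ^ 2) μ :=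
    integrable_finsetSum _ fun l hl => (hm l hl).1.integrable_norm_sq
  refine (integral_mono h1.integrable_norm_sq (i1.const_mul (r : ℝ)) fun ω => ?_).trans ?_
  · simpa using norm_sum_sq_le (Finset.range r) fun l =>
      act (centred W π (s + l) (r - l) ω) (embed κ (𝐦 (s + l) ω))
  · rw [integral_const_mul, integral_finsetSum _ fun l hl => (hm l hl).1.integrable_norm_sq,
      mul_assoc, Finset.mul_sum (Finset.range r) _ (β ^ 2)]
    have h2 : (r : ℝ) ≤ τ := by exact_mod_cast hr
    refine mul_le_mul h2 (Finset.sum_le_sum fun l hl => (hm l hl).2)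
      (Finset.sum_nonneg fun l _ => integral_nonneg fun ω => by positivity) (by positivity)

/-- In contrast to the means, there is no factor `τ`: noises of different rounds are orthogonal even
after propagation. -/
theorem memLp_sum_noises (h : Setting μ 𝒟 F ξ W π p τ β L xs) (s : ℕ) {r : ℕ} (hr : r ≤ τ) :
    MemLp (fun ω => ∑ l ∈ Finset.range r,
      act (centred W π (s + l) (r - l) ω) (embed κ (𝐧 (s + l) ω))) 2 μ ∧
    ∫ ω, ‖∑ l ∈ Finset.range r,
      act (centred W π (s + l) (r - l) ω) (embed κ (𝐧 (s + l) ω))‖ ^ 2 ∂μ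
      ≤ β ^ 2 * ∑ l ∈ Finset.range r, ∫ ω, ‖embed κ (𝐧 (s + l) ω)‖ ^ 2 ∂μ := by
  have hm : ∀ l ∈ Finset.range r, _ := fun l hl =>
    h.memLp_act_noises (η := η) (x₀ := x₀) (k := s + l) (r := r - l)
      (by have := Finset.mem_range.1 hl; omega) (by omega)
  refine ⟨memLp_finsetSum _ fun l hl => (hm l hl).1, ?_⟩
  -- The earlier term may share weight matrices with the later one, but it involves no sample of
  -- round `s + b`. Conditioning on all weights is allowed, as they are independent of the samples.
  have horth : ∀ a ∈ Finset.range r, ∀ b ∈ Finset.range r, a < b →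
      ∫ ω, inner ℝ (act (centred W π (s + a) (r - a) ω) (embed κ (𝐧 (s + a) ω)))
        (act (centred W π (s + b) (r - b) ω) (embed κ (𝐧 (s + b) ω))) ∂μ = 0 := by
    intro a ha b hb hab
    refine h.integral_inner_act_noises (by have := Finset.mem_range.1 hb; omega) (by omega)
      (fun n => measurable_act
        (measurable_centred (measurable_gossipProd_sample_compl (s + a) (r - a) (s + b) n))
        (measurable_embed fun m => h.measurable_noises (past_sample_compl (by omega) n) ?_))
      (hm a ha).1
    simp only [Set.mem_compl_iff, Set.mem_singleton_iff, Sum.inr.injEq, Prod.mk.injEq, not_and]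
    omega
  rw [integral_norm_sum_sq _ (fun l hl => (hm l hl).1), Finset.mul_sum]
  · exact Finset.sum_le_sum fun l hl => (hm l hl).2
  · intro a ha b hb hab
    rcases lt_or_gt_of_ne hab with hab | hab
    · exact horth a ha b hb hab
    · simp_rw [real_inner_comm (act (centred W π (s + b) (r - b) _) _)]
      exact horth b hb a ha hab

theorem integral_inner_sum_noises (h : Setting μ 𝒟 F ξ W π p τ β L xs) (s : ℕ) {r : ℕ}
    (hr : r ≤ τ) {Z : Ω → Stack (ι ⊕ κ) d}
    (hZ : ∀ l n, Measurable[infoOn W ξ {.inr (s + l, n)}ᶜ] Z) (hZ2 : MemLp Z 2 μ) :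
    ∫ ω, inner ℝ (Z ω) (∑ l ∈ Finset.range r,
      act (centred W π (s + l) (r - l) ω) (embed κ (𝐧 (s + l) ω))) ∂μ = 0 := by
  simp_rw [inner_sum]
  rw [integral_finsetSum]
  · exact Finset.sum_eq_zero fun l hl => h.integral_inner_act_noises
      (by have := Finset.mem_range.1 hl; omega) (by omega) (hZ l) hZ2
  · exact fun l hl => hZ2.integrable_inner_two (h.memLp_act_noises
      (by have := Finset.mem_range.1 hl; omega) (by omega)).1

theorem act_sub_limit_eq_neg (s r : ℕ) (ω : Ω) (Z : Stack (ι ⊕ κ) d) :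
    act (gossipProd W s r ω - limitMatrix π) Z
      = -act (limitMatrix π - gossipProd W s r ω) Z := by
  rw [act_sub_matrix, act_sub_matrix, neg_sub]

/-- The deviations at the start of a block are contracted; at round `0` there are none. -/
theorem memLp_contraction (h : Setting μ 𝒟 F ξ W π p τ β L xs) {s r : ℕ}
    (hsr : r = τ ∨ s = 0) :
    MemLp (fun ω => act (gossipProd W s r ω - limitMatrix π) (𝐝 s ω)) 2 μ ∧
      ∫ ω, ‖act (gossipProd W s r ω - limitMatrix π) (𝐝 s ω)‖ ^ 2 ∂μ
        ≤ (1 - p) * ∫ ω, ‖𝐝 s ω‖ ^ 2 ∂μ := by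
  rcases hsr with rfl | rfl
  · have hc := h.gossip.contraction s
    have key := memLp_act_of_indep (h.random.infoOn_le _) (h.random.infoOn_le _)
      (h.weight_indep s) (A := fun ω => limitMatrix π - gossipProd W s r ω)
      (fun i j => (measurable_gossipProd_weightsFrom s r i j).const_sub _)
      (h.measurable_dev (η := η) (x₀ := x₀) (past_weightsFrom_compl le_rfl)) hc.1
      (h.memLp_dev s)
    simp_rw [act_sub_limit_eq_neg, norm_neg]
    exact ⟨key.1.neg, key.2.trans
      (mul_le_mul_of_nonneg_right hc.2 (integral_nonneg fun ω => by positivity))⟩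
  -- A block shorter than `τ` has no contraction assumption, but it starts at round `0`, where all
  -- nodes agree.
  · have h0 : ∀ ω, 𝐝 0 ω = 0 := dev_zero h.gossip.sum_eq_one
    simp [h0]

/-- Young's inequality is spent on the means only; the cross term of the noise with the old
deviations has mean zero. -/
theorem integral_dev_sq_block (h : Setting μ 𝒟 F ξ W π p τ β L xs) {s r : ℕ}
    (hr : r ≤ τ) (hsr : r = τ ∨ s = 0) :
    ∫ ω, ‖𝐝 (s + r) ω‖ ^ 2 ∂μ ≤ (1 - p / 2) * ∫ ω, ‖𝐝 s ω‖ ^ 2 ∂μ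
      + ∑ l ∈ Finset.range r, (4 / p * η ^ 2 * (τ * β ^ 2) * ∫ ω, ‖embed κ (𝐦 (s + l) ω)‖ ^ 2 ∂μ
        + 2 * η ^ 2 * β ^ 2 * ∫ ω, ‖embed κ (𝐧 (s + l) ω)‖ ^ 2 ∂μ) := by
  have hp := h.gossip.p_pos
  obtain ⟨B, hB⟩ : ∃ B, B = fun ω => act (gossipProd W s r ω - limitMatrix π) (𝐝 s ω) := ⟨_, rfl⟩
  obtain ⟨M, hM⟩ : ∃ M, M = fun ω => ∑ l ∈ Finset.range r,
      act (centred W π (s + l) (r - l) ω) (embed κ (𝐦 (s + l) ω)) := ⟨_, rfl⟩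
  obtain ⟨N, hN⟩ : ∃ N, N = fun ω => ∑ l ∈ Finset.range r,
      act (centred W π (s + l) (r - l) ω) (embed κ (𝐧 (s + l) ω)) := ⟨_, rfl⟩
  have kB := h.memLp_contraction (η := η) (x₀ := x₀) hsr
  have kM := h.memLp_sum_means (η := η) (x₀ := x₀) s hr
  have kN := h.memLp_sum_noises (η := η) (x₀ := x₀) s hr
  have kBN : ∫ ω, inner ℝ (B ω) (N ω) ∂μ = 0 := by
    rw [hN]
    refine h.integral_inner_sum_noises s hr (fun l n => ?_) (by rw [hB]; exact kB.1)
    rw [hB]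
    exact measurable_act (A := fun ω => gossipProd W s r ω - limitMatrix π)
      (fun i j => (measurable_gossipProd_sample_compl s r (s + l) n i j).sub_const _)
      (h.measurable_dev (past_sample_compl (by omega) n))
  have eB : ∀ ω, act (gossipProd W s r ω - limitMatrix π) (𝐝 s ω) = B ω := fun ω => by rw [hB]
  have eM : ∀ ω, ∑ l ∈ Finset.range r,
      act (centred W π (s + l) (r - l) ω) (embed κ (𝐦 (s + l) ω)) = M ω := fun ω => by rw [hM]
  have eN : ∀ ω, ∑ l ∈ Finset.range r,
      act (centred W π (s + l) (r - l) ω) (embed κ (𝐧 (s + l) ω)) = N ω := fun ω => by rw [hN]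
  simp_rw [eB] at kB
  simp_rw [eM] at kM
  simp_rw [eN] at kN
  have hdev : ∀ᵐ ω ∂μ, 𝐝 (s + r) ω = B ω - η • (M ω + N ω) := by
    filter_upwards [h.gossip.ae_fixesLimit] with ω hω
    rw [hω.dev_add, hB, hM, hN]
    simp only [← Finset.sum_add_distrib, ← map_add, ← embed_add, centred]
    congr 2
    refine Finset.sum_congr rfl fun l _ => ?_
    congr 2
    ext1 n
    exact grads_eq _ _ _
  have iBN := (kB.1.integrable_inner_two kN.1).const_mul (2 * η)
  have iN := kN.1.integrable_norm_sq.const_mul (2 * η ^ 2)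
  have iB := kB.1.integrable_norm_sq.const_mul (1 + p / 2)
  have iM := kM.1.integrable_norm_sq.const_mul (4 / p * η ^ 2)
  have iD : Integrable (fun ω => 2 * η ^ 2 * ‖N ω‖ ^ 2 - 2 * η * inner ℝ (B ω) (N ω)) μ :=
    iN.sub iBN
  have step : ∫ ω, ‖𝐝 (s + r) ω‖ ^ 2 ∂μ ≤ ∫ ω, ((1 + p / 2) * ‖B ω‖ ^ 2
      + 4 / p * η ^ 2 * ‖M ω‖ ^ 2
      + (2 * η ^ 2 * ‖N ω‖ ^ 2 - 2 * η * inner ℝ (B ω) (N ω))) ∂μ := by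
    refine integral_mono_ae (h.memLp_dev _).integrable_norm_sq ((iB.add iM).add iD) ?_
    filter_upwards [hdev] with ω hω
    rw [hω]
    exact norm_sub_smul_add_sq_le _ _ _ _ hp h.gossip.p_le_one
  rw [integral_add₃ iB iM iD, integral_sub iN iBN, integral_const_mul,
    integral_const_mul, integral_const_mul, integral_const_mul, kBN] at step
  have hU : 0 ≤ ∫ ω, ‖𝐝 s ω‖ ^ 2 ∂μ := integral_nonneg fun ω => by positivity
  -- `(1 + p/2)(1 - p) = 1 - p/2 - p²/2`: Young's inequality uses up half of the contraction.
  have s1 : (1 + p / 2) * ∫ ω, ‖B ω‖ ^ 2 ∂μ ≤ (1 - p / 2) * ∫ ω, ‖𝐝 s ω‖ ^ 2 ∂μ := by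
    have := mul_le_mul_of_nonneg_left kB.2 (by positivity : 0 ≤ 1 + p / 2)
    nlinarith [mul_nonneg (sq_nonneg p) hU]
  have s2 := mul_le_mul_of_nonneg_left kM.2 (by positivity : 0 ≤ 4 / p * η ^ 2)
  have s3 := mul_le_mul_of_nonneg_left kN.2 (by positivity : 0 ≤ 2 * η ^ 2)
  rw [Finset.sum_add_distrib, ← Finset.mul_sum, ← Finset.mul_sum]
  linarith

end Setting

end Block

/-! ### The averages over a round -/

section Descent

variable {ι κ Ω Ξ : Type*} [Fintype ι] [DecidableEq ι] [Nonempty ι] [Fintype κ] [DecidableEq κ]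
  [mΩ : MeasurableSpace Ω] [MeasurableSpace Ξ] {d : ℕ} {μ : Measure Ω} [IsProbabilityMeasure μ]
  {𝒟 : ι → Measure Ξ} [∀ n, IsProbabilityMeasure (𝒟 n)]
  {F : ι → EuclideanSpace ℝ (Fin d) → Ξ → ℝ} {ξ : ℕ → ι → Ω → Ξ}
  {W : ℕ → Ω → Matrix (ι ⊕ κ) (ι ⊕ κ) ℝ} {π : ι ⊕ κ → ℝ}
  {p : ℝ} {τ : ℕ} {β L η : ℝ} {xs x₀ : EuclideanSpace ℝ (Fin d)}

local notation "𝐱" => iterate W F π ξ η x₀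
local notation "𝐚" => avg W F π ξ η x₀
local notation "𝐝" => dev W F π ξ η x₀
local notation "𝐦" => means 𝒟 W F π ξ η x₀
local notation "𝐧" => noises 𝒟 W F π ξ η x₀

/-- A round of inexact gradient descent without noise. -/
theorem ConvexCosts.norm_mean_step_sq_le (hL : 0 ≤ L) (h : ConvexCosts 𝒟 F L xs) (hη : 0 ≤ η)
    (x : ι → EuclideanSpace ℝ (Fin d)) (y : EuclideanSpace ℝ (Fin d)) :
    ‖y - xs - η • ((1 / (Fintype.card ι : ℝ)) • ∑ n, gradient (localCost 𝒟 F n) (x n))‖ ^ 2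
      ≤ ‖y - xs‖ ^ 2 - (2 * η - 4 * η ^ 2 * L) * (globalCost 𝒟 F y - globalCost 𝒟 F xs)
        + (η * L + 2 * η ^ 2 * L ^ 2) / Fintype.card ι * ∑ n, ‖x n - y‖ ^ 2 := by
  have hN : (0 : ℝ) < Fintype.card ι := by exact_mod_cast Fintype.card_pos
  obtain ⟨c, hc⟩ : ∃ c, c = 1 / (Fintype.card ι : ℝ) := ⟨_, rfl⟩
  have hc0 : 0 < c := by rw [hc]; positivity
  have hcN : c * Fintype.card ι = 1 := by rw [hc]; field_simp
  obtain ⟨S, hS⟩ : ∃ S, S = ∑ n, ‖x n - y‖ ^ 2 := ⟨_, rfl⟩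
  obtain ⟨D, hD⟩ : ∃ D, D = globalCost 𝒟 F y - globalCost 𝒟 F xs := ⟨_, rfl⟩
  obtain ⟨m, hm⟩ : ∃ m, m = c • ∑ n, gradient (localCost 𝒟 F n) (x n) := ⟨_, rfl⟩
  have h1 : D - L / 2 * (c * S) ≤ inner ℝ m (y - xs) := by
    rw [hm, hD, hS, globalCost, globalCost, real_inner_smul_left, sum_inner, ← hc]
    have : c * ∑ n, localCost 𝒟 F n y - c * ∑ n, localCost 𝒟 F n xs
        - L / 2 * (c * ∑ n, ‖x n - y‖ ^ 2)
        = c * ∑ n, (localCost 𝒟 F n y - localCost 𝒟 F n xs - L / 2 * ‖x n - y‖ ^ 2) := by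
      rw [Finset.sum_sub_distrib, Finset.sum_sub_distrib, ← Finset.mul_sum]
      ring
    rw [this]
    gcongr with n
    exact (h.smoothConvex_localCost hL n).inner_ge (x n) y xs
  -- Compare with the gradient `g` of `f` at `y`: cocoercivity bounds `g`, the Lipschitz bound
  -- controls `m - g`.
  have h2 : ‖m‖ ^ 2 ≤ 4 * L * D + 2 * L ^ 2 * (c * S) := by
    obtain ⟨g, hg⟩ : ∃ g, g = c • ∑ n, gradient (localCost 𝒟 F n) y := ⟨_, rfl⟩
    have h3 : ‖g‖ ^ 2 ≤ 2 * L * D := by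
      have h4 := (h.smoothConvex_globalCost hL).cocoercive hL y xs
      simp only [bregman, h.sum_gradient_eq_zero hL, smul_zero, sub_zero, inner_zero_left] at h4
      rw [hg, hD, hc]
      exact h4
    have h5 : ‖m - g‖ ^ 2 ≤ L ^ 2 * (c * S) := by
      rw [hm, hg, ← smul_sub, ← Finset.sum_sub_distrib, norm_smul, mul_pow, Real.norm_eq_abs,
        sq_abs]
      have h6 := norm_sum_sq_le Finset.univ fun n =>
        gradient (localCost 𝒟 F n) (x n) - gradient (localCost 𝒟 F n) y
      have h7 : ∑ n, ‖gradient (localCost 𝒟 F n) (x n) - gradient (localCost 𝒟 F n) y‖ ^ 2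
          ≤ L ^ 2 * S := by
        rw [hS, Finset.mul_sum]
        refine Finset.sum_le_sum fun n _ => ?_
        rw [← mul_pow]
        exact pow_le_pow_left₀ (norm_nonneg _)
          ((h.smoothConvex_localCost hL n).lipschitz hL _ _) 2
      rw [Finset.card_univ] at h6
      calc _ ≤ c ^ 2 * (Fintype.card ι * (L ^ 2 * S)) := by gcongr; exact h6.trans (by gcongr)
        _ = L ^ 2 * (c * S) * (c * Fintype.card ι) := by ring
        _ = _ := by rw [hcN, mul_one]
    have h8 := norm_add_le (m - g) g
    rw [sub_add_cancel] at h8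
    nlinarith [sq_nonneg (‖m - g‖ - ‖g‖), norm_nonneg m]
  rw [← hc, ← hm, ← hS, ← hD, norm_sub_sq_real, inner_smul_right, norm_smul, mul_pow,
    Real.norm_eq_abs, sq_abs, real_inner_comm]
  have e : (η * L + 2 * η ^ 2 * L ^ 2) / Fintype.card ι * S
      = (η * L + 2 * η ^ 2 * L ^ 2) * (c * S) := by rw [hc]; ring
  rw [e]
  nlinarith [mul_le_mul_of_nonneg_left h1 hη, mul_le_mul_of_nonneg_left h2 (sq_nonneg η)]

namespace Setting

/-- The step splits into a noiseless inexact gradient step `A` and the averaged noise `B`, which are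
orthogonal. -/
theorem integral_avg_sq_succ (h : Setting μ 𝒟 F ξ W π p τ β L xs) (hη : 0 ≤ η) (k : ℕ) :
    ∫ ω, ‖𝐚 (k + 1) ω - xs‖ ^ 2 ∂μ ≤ ∫ ω, ‖𝐚 k ω - xs‖ ^ 2 ∂μ
      - (2 * η - 4 * η ^ 2 * L) * ∫ ω, (globalCost 𝒟 F (𝐚 k ω) - globalCost 𝒟 F xs) ∂μ
      + (η * L + 2 * η ^ 2 * L ^ 2) / Fintype.card ι * ∫ ω, ‖𝐝 k ω‖ ^ 2 ∂μ
      + (η / Fintype.card ι) ^ 2 * ∫ ω, ‖embed κ (𝐧 k ω)‖ ^ 2 ∂μ := by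
  have hN : (0 : ℝ) < Fintype.card ι := by exact_mod_cast Fintype.card_pos
  have hL := h.L_nonneg
  obtain ⟨A, hA⟩ : ∃ A, A = fun ω => 𝐚 k ω - xs
    - η • ((1 / (Fintype.card ι : ℝ)) • ∑ n, 𝐦 k ω n) := ⟨_, rfl⟩
  obtain ⟨B, hB⟩ : ∃ B, B = fun ω => (-(η / (Fintype.card ι : ℝ))) • ∑ n, 𝐧 k ω n := ⟨_, rfl⟩
  have hA2 : MemLp A 2 μ := by
    rw [hA]
    exact ((h.memLp_avg k).sub (memLp_const xs)).sub
      (((memLp_finsetSum _ fun n _ => h.memLp_means k n).const_smul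
        (1 / (Fintype.card ι : ℝ))).const_smul η)
  have hB2 : MemLp B 2 μ := by
    rw [hB]
    exact (memLp_finsetSum _ fun n _ => h.memLp_noises k n).const_smul
      (-(η / (Fintype.card ι : ℝ)))
  have hAB : ∫ ω, inner ℝ (A ω) (B ω) ∂μ = 0 := by
    simp_rw [hB, inner_smul_right, inner_sum]
    rw [integral_const_mul, integral_finsetSum _ fun n _ =>
      hA2.integrable_inner_two (h.memLp_noises k n)]
    refine mul_eq_zero_of_right _ (Finset.sum_eq_zero fun n _ => ?_)
    refine h.integral_inner_noises k n ?_ (hA2.integrable_inner_two (h.memLp_noises k n))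
    have hp : Past ({.inr (k, n)}ᶜ : Set (ℕ ⊕ ℕ × ι)) k := past_sample_compl le_rfl n
    rw [hA]
    refine measurable_sub_vec (measurable_sub_vec (h.measurable_avg hp) measurable_const) ?_
    exact measurable_const_smul_sum _ _ fun m => h.measurable_means hp m
  -- Orthogonality across nodes leaves `1/N²` in front of a sum of `N` variances, the source of the
  -- speed-up in `N`.
  have hBsq : ∫ ω, ‖B ω‖ ^ 2 ∂μ
      = (η / Fintype.card ι) ^ 2 * ∫ ω, ‖embed κ (𝐧 k ω)‖ ^ 2 ∂μ := by
    simp_rw [hB, norm_smul, mul_pow, norm_neg, Real.norm_eq_abs, sq_abs]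
    rw [integral_const_mul, integral_norm_embed_sq fun n => h.memLp_noises k n,
      integral_norm_sum_sq _ fun n _ => h.memLp_noises k n]
    intro a _ b _ hab
    have hp : Past ({.inr (k, b)}ᶜ : Set (ℕ ⊕ ℕ × ι)) k := past_sample_compl le_rfl b
    refine h.integral_inner_noises k b (h.measurable_noises hp ?_)
      ((h.memLp_noises k a).integrable_inner_two (h.memLp_noises k b))
    simpa using hab
  have hAsq : ∫ ω, ‖A ω‖ ^ 2 ∂μ ≤ ∫ ω, ‖𝐚 k ω - xs‖ ^ 2 ∂μ
      - (2 * η - 4 * η ^ 2 * L) * ∫ ω, (globalCost 𝒟 F (𝐚 k ω) - globalCost 𝒟 F xs) ∂μ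
      + (η * L + 2 * η ^ 2 * L ^ 2) / Fintype.card ι * ∫ ω, ‖𝐝 k ω‖ ^ 2 ∂μ := by
    have i1 : Integrable (fun ω => ‖𝐚 k ω - xs‖ ^ 2) μ :=
      ((h.memLp_avg k).sub (memLp_const xs)).integrable_norm_sq
    have i2 : Integrable (fun ω => (2 * η - 4 * η ^ 2 * L)
        * (globalCost 𝒟 F (𝐚 k ω) - globalCost 𝒟 F xs)) μ :=
      ((h.integrable_globalCost k).sub (integrable_const _)).const_mul _
    have i3 := (h.memLp_dev (η := η) (x₀ := x₀) k).integrable_norm_sq.const_mul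
      ((η * L + 2 * η ^ 2 * L ^ 2) / Fintype.card ι)
    have i12 : Integrable (fun ω => ‖𝐚 k ω - xs‖ ^ 2 - (2 * η - 4 * η ^ 2 * L)
        * (globalCost 𝒟 F (𝐚 k ω) - globalCost 𝒟 F xs)) μ := i1.sub i2
    rw [← integral_const_mul, ← integral_const_mul, ← integral_sub i1 i2, ← integral_add i12 i3]
    refine integral_mono hA2.integrable_norm_sq (i12.add i3) fun ω => ?_
    have h1 := h.costs.norm_mean_step_sq_le hL hη (fun n => 𝐱 k ω (.inl n)) (𝐚 k ω)
    have h2 := sum_dev_sq_le (W := W) (F := F) (π := π) (ξ := ξ) (η := η) (x₀ := x₀) k ω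
    rw [hA]
    exact h1.trans (add_le_add le_rfl (mul_le_mul_of_nonneg_left h2 (by positivity)))
  have hsucc : ∫ ω, ‖𝐚 (k + 1) ω - xs‖ ^ 2 ∂μ = ∫ ω, ‖A ω + B ω‖ ^ 2 ∂μ := by
    refine integral_congr_ae ?_
    filter_upwards [h.gossip.ae_fixesLimit] with ω hω
    have e : 𝐚 (k + 1) ω - xs = A ω + B ω := by
      rw [hω.avg_succ, hA, hB]
      simp_rw [grads_eq (𝒟 := 𝒟), Finset.sum_add_distrib]
      module
    rw [e]
  rw [hsucc, integral_norm_add_sq hA2 hB2, hAB, hBsq]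
  linarith

end Setting

end Descent

/-! ### Real recursions -/

section RealRecursions

/-- Truncated subtraction sends every `k ≤ τ` to index `0`, where `u` vanishes. -/
theorem sum_range_tsub {u : ℕ → ℝ} (h0 : u 0 = 0) (τ K : ℕ) :
    ∑ k ∈ Finset.range K, u (k - τ) = ∑ k ∈ Finset.range (K - τ), u k := by
  induction K with
  | zero => simp
  | succ K ih =>
    rw [Finset.sum_range_succ, ih]
    rcases lt_or_ge K τ with hK | hK
    · have e1 : K - τ = 0 := by omega
      have e2 : K + 1 - τ = 0 := by omega
      simp [e1, e2, h0]
    · have e : K + 1 - τ = (K - τ) + 1 := by omega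
      rw [e, Finset.sum_range_succ]

/-- Each index `l` lies in at most `τ` of the windows `[k - τ, k)`. -/
theorem sum_range_sum_Ico_le {e : ℕ → ℝ} (he : ∀ k, 0 ≤ e k) (τ K : ℕ) :
    ∑ k ∈ Finset.range K, ∑ l ∈ Finset.Ico (k - τ) k, e l
      ≤ τ * ∑ k ∈ Finset.range K, e k := by
  rw [Finset.sum_comm' (t' := Finset.range K)
    (s' := fun l => (Finset.Ioc l (l + τ)).filter (· < K))]
  · rw [Finset.mul_sum]
    refine Finset.sum_le_sum fun l _ => ?_
    rw [Finset.sum_const, nsmul_eq_mul]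
    refine mul_le_mul_of_nonneg_right ?_ (he l)
    have := Finset.card_filter_le (Finset.Ioc l (l + τ)) (· < K)
    rw [Nat.card_Ioc, add_tsub_cancel_left] at this
    exact_mod_cast this
  · intro k l
    simp only [Finset.mem_range, Finset.mem_Ico, Finset.mem_filter, Finset.mem_Ioc]
    omega

/-- Summing a recursion that contracts over blocks of `τ` steps. -/
theorem sum_le_of_block_contraction {u e : ℕ → ℝ} {p : ℝ} {τ : ℕ} (hp : 0 < p) (hp1 : p ≤ 1)
    (h0 : u 0 = 0) (hu : ∀ k, 0 ≤ u k) (he : ∀ k, 0 ≤ e k)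
    (h : ∀ k, u k ≤ (1 - p / 2) * u (k - τ) + ∑ l ∈ Finset.Ico (k - τ) k, e l) (K : ℕ) :
    ∑ k ∈ Finset.range K, u k ≤ 2 * τ / p * ∑ k ∈ Finset.range K, e k := by
  have h1 := Finset.sum_le_sum fun k (_ : k ∈ Finset.range K) => h k
  rw [Finset.sum_add_distrib, ← Finset.mul_sum, sum_range_tsub h0] at h1
  have h2 : ∑ k ∈ Finset.range (K - τ), u k ≤ ∑ k ∈ Finset.range K, u k :=
    Finset.sum_le_sum_of_subset_of_nonneg (Finset.range_mono (Nat.sub_le _ _))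
      fun k _ _ => hu k
  have h3 := sum_range_sum_Ico_le he τ K
  have h4 := mul_le_mul_of_nonneg_left h2 (by linarith : 0 ≤ 1 - p / 2)
  have h5 : p / 2 * ∑ k ∈ Finset.range K, u k ≤ τ * ∑ k ∈ Finset.range K, e k := by linarith
  have h6 : ∑ k ∈ Finset.range K, u k = 2 / p * (p / 2 * ∑ k ∈ Finset.range K, u k) := by
    field_simp
  rw [h6, mul_div_right_comm, mul_assoc (2 / p)]
  exact mul_le_mul_of_nonneg_left h5 (by positivity)

/-- Combining the summed estimates: `U`, `D`, `M` and `V` are the sums over `K` rounds of the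
squared deviations, the optimality gaps, the squared gradients and the squared noise. -/
theorem gap_le_of_summed_estimates {N K L η p τ β ζ σ T U D M V R R' : ℝ}
    (hN : 1 ≤ N) (hK : 0 ≤ K) (hL : 0 ≤ L) (hη : 0 < η) (hp : 0 < p) (hp1 : p ≤ 1) (hτ : 1 ≤ τ)
    (hβ : 0 < β) (hpβ : p ≤ β * τ) (hU : 0 ≤ U) (hD : 0 ≤ D) (hR' : 0 ≤ R')
    (hT : ζ ^ 2 * τ ^ 2 + σ ^ 2 * (p * τ) ≤ T ^ 2)
    (hdev : U ≤ 2 * τ / p * (4 / p * η ^ 2 * (τ * β ^ 2) * M + 2 * η ^ 2 * β ^ 2 * V))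
    (hM : M ≤ 3 * L ^ 2 * U + 6 * L * (N * D) + K * (3 * (N * ζ ^ 2)))
    (hV : V ≤ 3 * L ^ 2 * U + 6 * L * (N * D) + K * (3 * (N * σ ^ 2)))
    (hdescent : R' ≤ R - (2 * η - 4 * η ^ 2 * L) * D + (η * L + 2 * η ^ 2 * L ^ 2) / N * U
      + (η / N) ^ 2 * V)
    (hstep : η * (β * L * τ / p) ≤ 1 / 40) :
    η * D ≤ R + η * K * (29 * (L * (η * β * T / p) ^ 2) + 3 * (η * σ ^ 2 / N)) := by
  have hN0 : 0 < N := by linarith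
  -- `q` is the effective step size that the constraint bounds by `q L ≤ 1/40`; `G` collects the
  -- errors at `x⋆`.
  obtain ⟨q, hq⟩ : ∃ q, q = η * β * τ / p := ⟨_, rfl⟩
  obtain ⟨G, hG⟩ : ∃ G, G = (η * β * T / p) ^ 2 := ⟨_, rfl⟩
  have hq0 : 0 < q := by rw [hq]; positivity
  have hqL : q * L ≤ 1 / 40 := by
    have : q * L = η * (β * L * τ / p) := by rw [hq]; ring
    linarith
  have hηL : η * L ≤ 1 / 40 := by
    -- This is what `p ≤ β τ` is for: the constraint on `q` also bounds `η L`.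
    have h1 : η ≤ q := by
      rw [hq, le_div_iff₀ hp]
      nlinarith
    nlinarith
  have hηL0 : 0 ≤ η * L := by positivity
  have hE0 : 0 ≤ 3 * L ^ 2 * U + 6 * L * (N * D) := by positivity
  -- The noise coefficient `4η²β²τ/p` is at most `4q²` since `p ≤ 1 ≤ τ`. The coarse form suffices
  -- for the feedback terms; the noise at `x⋆` keeps the sharp one.
  have hcoefV : 2 * τ / p * (2 * η ^ 2 * β ^ 2) ≤ 4 * q ^ 2 := by
    have e : 4 * q ^ 2 - 2 * τ / p * (2 * η ^ 2 * β ^ 2)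
        = 4 * η ^ 2 * β ^ 2 * τ / p ^ 2 * (τ - p) := by rw [hq]; field_simp; ring
    have : 0 ≤ 4 * η ^ 2 * β ^ 2 * τ / p ^ 2 * (τ - p) :=
      mul_nonneg (by positivity) (by linarith)
    linarith
  have hcoefM : 2 * τ / p * (4 / p * η ^ 2 * (τ * β ^ 2)) = 8 * q ^ 2 := by
    rw [hq]; field_simp; ring
  have hU1 : U ≤ 12 * q ^ 2 * (3 * L ^ 2 * U + 6 * L * (N * D)) + 24 * (K * (N * G)) := by
    have h1 : U ≤ 8 * q ^ 2 * (3 * L ^ 2 * U + 6 * L * (N * D) + K * (3 * (N * ζ ^ 2)))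
        + 2 * τ / p * (2 * η ^ 2 * β ^ 2)
          * (3 * L ^ 2 * U + 6 * L * (N * D) + K * (3 * (N * σ ^ 2))) := by
      rw [← hcoefM]
      have a1 := mul_le_mul_of_nonneg_left hM
        (by positivity : 0 ≤ 2 * τ / p * (4 / p * η ^ 2 * (τ * β ^ 2)))
      have a2 := mul_le_mul_of_nonneg_left hV
        (by positivity : 0 ≤ 2 * τ / p * (2 * η ^ 2 * β ^ 2))
      linarith
    have h2 := mul_le_mul_of_nonneg_right hcoefV hE0
    have h3 : 8 * q ^ 2 * (K * (3 * (N * ζ ^ 2)))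
        + 2 * τ / p * (2 * η ^ 2 * β ^ 2) * (K * (3 * (N * σ ^ 2)))
        = K * N * (24 * (η * β / p) ^ 2 * (ζ ^ 2 * τ ^ 2)
          + 12 * (η * β / p) ^ 2 * (σ ^ 2 * (p * τ))) := by
      rw [hq]; field_simp; ring
    have h4 : 24 * (η * β / p) ^ 2 * (ζ ^ 2 * τ ^ 2)
          + 12 * (η * β / p) ^ 2 * (σ ^ 2 * (p * τ)) ≤ 24 * G := by
      have e : 24 * G = 24 * ((η * β / p) ^ 2 * T ^ 2) := by rw [hG]; ring
      have h5 := mul_le_mul_of_nonneg_left hT (sq_nonneg (η * β / p))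
      have h6 : 0 ≤ (η * β / p) ^ 2 * (σ ^ 2 * (p * τ)) := by positivity
      rw [mul_add] at h5
      rw [e, mul_assoc, mul_assoc]
      linarith
    have h7 := mul_le_mul_of_nonneg_left h4 (by positivity : 0 ≤ K * N)
    linarith
  have hq2 : q ^ 2 * L ^ 2 ≤ 1 / 1600 := by
    have : (q * L) ^ 2 ≤ (1 / 40) ^ 2 := pow_le_pow_left₀ (by positivity) hqL 2
    rw [mul_pow] at this
    linarith
  have hG0 : 0 ≤ G := by rw [hG]; positivity
  -- The terms in `U` on the right have total weight at most `36/1600`. Moving them left turns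
  -- `72/1600` into at most `1/20`, and `24` into at most `25`.
  have hLU : L * U / N ≤ D / 20 + 25 * (K * (L * G)) := by
    rw [div_le_iff₀ hN0]
    have h1 := mul_le_mul_of_nonneg_left hU1 hL
    have h2 := mul_le_mul_of_nonneg_right hq2 (by positivity : 0 ≤ L * U)
    have h3 := mul_le_mul_of_nonneg_right hq2 (by positivity : 0 ≤ N * D)
    have h4 : 0 ≤ K * (L * G) * N := by positivity
    have h5 : 0 ≤ N * D := by positivity
    linarith
  have hV1 : (η / N) ^ 2 * V ≤ 3 * η ^ 2 * L * (L * U / N) + 6 * η ^ 2 * L * D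
      + η * K * (3 * (η * σ ^ 2 / N)) := by
    have h1 := mul_le_mul_of_nonneg_left hV (sq_nonneg (η / N))
    have h2 : (η / N) ^ 2 * (3 * L ^ 2 * U + 6 * L * (N * D) + K * (3 * (N * σ ^ 2)))
        = 1 / N * (3 * η ^ 2 * L * (L * U / N) + 6 * η ^ 2 * L * D)
          + η * K * (3 * (η * σ ^ 2 / N)) := by
      field_simp
    -- The factor `1/N` is dropped from the feedback but kept with `σ²`.
    have h3 : 1 / N ≤ 1 := by rw [div_le_one hN0]; exact hN
    have h4 : 0 ≤ 3 * η ^ 2 * L * (L * U / N) + 6 * η ^ 2 * L * D := by positivity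
    have h5 := mul_le_mul_of_nonneg_right h3 h4
    linarith
  have hX0 : 0 ≤ L * U / N := by positivity
  obtain ⟨X, hX⟩ : ∃ X, X = L * U / N := ⟨_, rfl⟩
  have e2 : (η * L + 2 * η ^ 2 * L ^ 2) / N * U = η * X + 2 * η * (η * L) * X := by
    rw [hX]; field_simp
  rw [e2] at hdescent
  rw [← hX] at hLU hV1 hX0
  -- With `ηL ≤ 1/40` the gap retains a coefficient of at least `2 - 1/4 - (9/8)/20 ≥ 1` times `η`,
  -- and `(9/8) · 25 ≤ 29`.
  have a1 := mul_le_mul_of_nonneg_right hηL (by positivity : 0 ≤ η * X)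
  have a2 := mul_le_mul_of_nonneg_right hηL (by positivity : 0 ≤ η * D)
  have a3 := mul_le_mul_of_nonneg_left hLU hη.le
  have a4 : 0 ≤ η * (K * (L * G)) := by positivity
  have a5 : 0 ≤ η * D := by positivity
  rw [← hG]
  linarith

/-- A step size that meets the constraint and makes the initial distance negligible. -/
theorem exists_stepSize {ε R A : ℝ} (hε : 0 < ε) (hR : 0 ≤ R) (hA : 0 ≤ A) :
    ∃ η : ℝ, 0 < η ∧ η * (ε * A) ≤ 1 / 40 ∧
      ∀ K : ℝ, 1 ≤ K → 100 * (A * R) ≤ K → R ≤ η * K * (ε / 2) := by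
  rcases hA.eq_or_lt with rfl | hA
  -- If the order vanishes there is no constraint on the step, and it is taken so large that already
  -- `K = 1` works.
  · refine ⟨2 * R / ε + 1, by positivity, by simp, fun K hK _ => ?_⟩
    have h1 : R ≤ (2 * R / ε + 1) * (ε / 2) := by
      have : (2 * R / ε + 1) * (ε / 2) = R + ε / 2 := by field_simp
      linarith
    have h2 : 0 ≤ (2 * R / ε + 1) * (ε / 2) := by positivity
    nlinarith
  -- The largest step allowed; then `η K ε / 2 = K / (80 A)`, so `K ≥ 80 A R` would suffice.
  · refine ⟨1 / (40 * (ε * A)), by positivity, le_of_eq ?_, fun K _ hK' => ?_⟩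
    · field_simp
    · have : 1 / (40 * (ε * A)) * K * (ε / 2) = K / (80 * A) := by field_simp; norm_num
      rw [this, le_div_iff₀ (by positivity)]
      nlinarith [mul_nonneg hA.le hR]

end RealRecursions

/-! ### Summing the recursions -/

section Summation

variable {ι κ Ω Ξ : Type*} [Fintype ι] [DecidableEq ι] [Nonempty ι] [Fintype κ] [DecidableEq κ]
  [mΩ : MeasurableSpace Ω] [MeasurableSpace Ξ] {d : ℕ} {μ : Measure Ω} [IsProbabilityMeasure μ]
  {𝒟 : ι → Measure Ξ} [∀ n, IsProbabilityMeasure (𝒟 n)]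
  {F : ι → EuclideanSpace ℝ (Fin d) → Ξ → ℝ} {ξ : ℕ → ι → Ω → Ξ}
  {W : ℕ → Ω → Matrix (ι ⊕ κ) (ι ⊕ κ) ℝ} {π : ι ⊕ κ → ℝ}
  {p : ℝ} {τ : ℕ} {β L η : ℝ} {xs x₀ : EuclideanSpace ℝ (Fin d)}

local notation "𝐱" => iterate W F π ξ η x₀
local notation "𝐚" => avg W F π ξ η x₀
local notation "𝐝" => dev W F π ξ η x₀
local notation "𝐦" => means 𝒟 W F π ξ η x₀
local notation "𝐧" => noises 𝒟 W F π ξ η x₀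

theorem iterationOrder_nonneg {N : ℕ} {p σ ζ ε : ℝ} (hL : 0 ≤ L) (hβ : 0 ≤ β)
    (hp : 0 ≤ p) (hσ : 0 ≤ σ) (hζ : 0 ≤ ζ) (hε : 0 ≤ ε) :
    0 ≤ iterationOrder N L β p τ σ ζ ε := by
  unfold iterationOrder
  positivity

namespace Setting

theorem gap_nonneg (h : Setting μ 𝒟 F ξ W π p τ β L xs) (k : ℕ) :
    0 ≤ ∫ ω, (globalCost 𝒟 F (𝐚 k ω) - globalCost 𝒟 F xs) ∂μ :=
  integral_nonneg fun _ => sub_nonneg.2 (h.costs.minimizer _)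

theorem sum_dev_le (h : Setting μ 𝒟 F ξ W π p τ β L xs) (K : ℕ) :
    ∑ k ∈ Finset.range K, ∫ ω, ‖𝐝 k ω‖ ^ 2 ∂μ ≤ 2 * τ / p
      * (4 / p * η ^ 2 * (τ * β ^ 2) * ∑ k ∈ Finset.range K, ∫ ω, ‖embed κ (𝐦 k ω)‖ ^ 2 ∂μ
        + 2 * η ^ 2 * β ^ 2 * ∑ k ∈ Finset.range K, ∫ ω, ‖embed κ (𝐧 k ω)‖ ^ 2 ∂μ) := by
  have hp := h.gossip.p_pos
  have hnn : ∀ f : Ω → Stack (ι ⊕ κ) d, 0 ≤ ∫ ω, ‖f ω‖ ^ 2 ∂μ :=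
    fun f => integral_nonneg fun ω => by positivity
  have key := sum_le_of_block_contraction (u := fun k => ∫ ω, ‖𝐝 k ω‖ ^ 2 ∂μ)
    (e := fun k => 4 / p * η ^ 2 * (τ * β ^ 2) * ∫ ω, ‖embed κ (𝐦 k ω)‖ ^ 2 ∂μ
        + 2 * η ^ 2 * β ^ 2 * ∫ ω, ‖embed κ (𝐧 k ω)‖ ^ 2 ∂μ) (τ := τ) hp h.gossip.p_le_one
    (by
      have h0 : ∀ ω, 𝐝 0 ω = 0 := dev_zero h.gossip.sum_eq_one
      simp [h0])
    (fun k => hnn _)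
    (fun k => add_nonneg (mul_nonneg (by positivity) (hnn _)) (mul_nonneg (by positivity) (hnn _)))
    (fun k => by
      -- The block ends at round `k`; by truncated subtraction it has length `τ` or starts at round
      -- `0`.
      have := h.integral_dev_sq_block (η := η) (x₀ := x₀) (s := k - τ) (r := k - (k - τ))
        (by omega) (by omega)
      rw [Finset.sum_Ico_eq_sum_range]
      have e : k - τ + (k - (k - τ)) = k := by omega
      rw [e] at this
      exact this) K
  rwa [Finset.sum_add_distrib, ← Finset.mul_sum, ← Finset.mul_sum] at key

theorem sum_descent (h : Setting μ 𝒟 F ξ W π p τ β L xs) (hη : 0 ≤ η) (K : ℕ) :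
    ∫ ω, ‖𝐚 K ω - xs‖ ^ 2 ∂μ ≤ ∫ ω, ‖𝐚 0 ω - xs‖ ^ 2 ∂μ
      - (2 * η - 4 * η ^ 2 * L) * ∑ k ∈ Finset.range K,
        ∫ ω, (globalCost 𝒟 F (𝐚 k ω) - globalCost 𝒟 F xs) ∂μ
      + (η * L + 2 * η ^ 2 * L ^ 2) / Fintype.card ι
        * ∑ k ∈ Finset.range K, ∫ ω, ‖𝐝 k ω‖ ^ 2 ∂μ
      + (η / Fintype.card ι) ^ 2
        * ∑ k ∈ Finset.range K, ∫ ω, ‖embed κ (𝐧 k ω)‖ ^ 2 ∂μ := by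
  induction K with
  | zero => simp
  | succ K ih =>
    have := h.integral_avg_sq_succ (x₀ := x₀) hη K
    simp only [Finset.sum_range_succ, mul_add]
    linarith

/-- The optimality gaps summed over `K` rounds. -/
theorem sum_gap_le (h : Setting μ 𝒟 F ξ W π p τ β L xs) (hη : 0 < η) (hpβ : p ≤ β * τ)
    (hstep : η * (β * L * τ / p) ≤ 1 / 40) (K : ℕ) :
    η * ∑ k ∈ Finset.range K, ∫ ω, (globalCost 𝒟 F (𝐚 k ω) - globalCost 𝒟 F xs) ∂μ
      ≤ ‖weightedAverage π (fun _ : ι ⊕ κ => x₀) - xs‖ ^ 2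
        + η * K * (29 * (L * (η * β * (heterogeneity 𝒟 F xs * τ
          + noiseLevel 𝒟 F xs * √(p * τ)) / p) ^ 2)
          + 3 * (η * noiseLevel 𝒟 F xs ^ 2 / Fintype.card ι)) := by
  have hp := h.gossip.p_pos
  have hζ : 0 ≤ heterogeneity 𝒟 F xs := Real.sqrt_nonneg _
  have hσ : 0 ≤ noiseLevel 𝒟 F xs := Real.sqrt_nonneg _
  have hR : ‖weightedAverage π (fun _ : ι ⊕ κ => x₀) - xs‖ ^ 2
      = ∫ ω, ‖𝐚 0 ω - xs‖ ^ 2 ∂μ := by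
    simp [avg, iterate]
  rw [hR]
  refine gap_le_of_summed_estimates (N := Fintype.card ι)
    (U := ∑ k ∈ Finset.range K, ∫ ω, ‖𝐝 k ω‖ ^ 2 ∂μ)
    (M := ∑ k ∈ Finset.range K, ∫ ω, ‖embed κ (𝐦 k ω)‖ ^ 2 ∂μ)
    (V := ∑ k ∈ Finset.range K, ∫ ω, ‖embed κ (𝐧 k ω)‖ ^ 2 ∂μ)
    (ζ := heterogeneity 𝒟 F xs) (R' := ∫ ω, ‖𝐚 K ω - xs‖ ^ 2 ∂μ)
    (by exact_mod_cast Fintype.card_pos) (by positivity) h.L_nonneg hη hp h.gossip.p_le_one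
    (by exact_mod_cast h.gossip.one_le_tau) h.gossip.beta_pos hpβ
    (Finset.sum_nonneg fun k _ => integral_nonneg fun ω => by positivity)
    (Finset.sum_nonneg fun k _ => h.gap_nonneg k) (integral_nonneg fun ω => by positivity)
    ?_ (h.sum_dev_le K) ?_ ?_ (h.sum_descent hη.le K) hstep
  -- `T = ζτ + σ√(pτ)`, and its square dominates the sum of squares because the cross term is
  -- nonnegative.
  · have e : √(p * τ) ^ 2 = p * τ := Real.sq_sqrt (by positivity)
    have : 0 ≤ heterogeneity 𝒟 F xs * τ * (noiseLevel 𝒟 F xs * √(p * τ)) := by positivity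
    nlinarith
  · refine (Finset.sum_le_sum fun k _ => h.integral_means_sq_le k).trans_eq ?_
    simp only [Finset.sum_add_distrib, ← Finset.mul_sum, Finset.sum_const, Finset.card_range,
      nsmul_eq_mul]
    ring
  · refine (Finset.sum_le_sum fun k _ => h.integral_noises_sq_le k).trans_eq ?_
    simp only [Finset.sum_add_distrib, ← Finset.mul_sum, Finset.sum_const, Finset.card_range,
      nsmul_eq_mul]
    ring

/-- The averaged optimality gap is at most `ε` once `K` is of the order `iterationOrder`. -/
theorem exists_stepSize_average_gap_le (h : Setting μ 𝒟 F ξ W π p τ β L xs)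
    (hpβ : p ≤ β * τ) {ε : ℝ} (hε : 0 < ε) :
    ∃ η : ℝ, 0 < η ∧ ∀ K : ℕ, 1 ≤ K →
      100 * (iterationOrder (Fintype.card ι) L β p τ (noiseLevel 𝒟 F xs)
          (heterogeneity 𝒟 F xs) ε
        * ‖weightedAverage π (fun _ : ι ⊕ κ => x₀) - xs‖ ^ 2) ≤ K →
      (1 / (K : ℝ)) * ∑ k ∈ Finset.range K,
          ∫ ω, globalCost 𝒟 F (avg W F π ξ η x₀ k ω) ∂μ - globalCost 𝒟 F xs ≤ ε := by
  have hN : (0 : ℝ) < Fintype.card ι := by exact_mod_cast Fintype.card_pos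
  have hp := h.gossip.p_pos
  have hβ := h.gossip.beta_pos
  have hL := h.L_nonneg
  obtain ⟨ζ, hζe⟩ : ∃ ζ, ζ = heterogeneity 𝒟 F xs := ⟨_, rfl⟩
  obtain ⟨σ, hσe⟩ : ∃ σ, σ = noiseLevel 𝒟 F xs := ⟨_, rfl⟩
  have hζ : 0 ≤ ζ := hζe ▸ Real.sqrt_nonneg _
  have hσ : 0 ≤ σ := hσe ▸ Real.sqrt_nonneg _
  rw [← hζe, ← hσe]
  obtain ⟨η, hη, hstep, hK⟩ := exists_stepSize hε
    (sq_nonneg ‖weightedAverage π (fun _ : ι ⊕ κ => x₀) - xs‖)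
    (iterationOrder_nonneg (N := Fintype.card ι) (τ := τ) hL hβ.le hp.le hσ hζ hε.le)
  refine ⟨η, hη, fun K hK1 hKle => ?_⟩
  have hK0 : (0 : ℝ) < K := by exact_mod_cast hK1
  obtain ⟨T, hT⟩ : ∃ T, T = ζ * τ + σ * √(p * τ) := ⟨_, rfl⟩
  have hT0 : 0 ≤ T := by rw [hT]; positivity
  have hsε : 0 < √ε := Real.sqrt_pos.2 hε
  have hsε2 : √ε ^ 2 = ε := Real.sq_sqrt hε.le
  have hsL2 : √L ^ 2 = L := Real.sq_sqrt hL
  have hpow : ε ^ (3 / 2 : ℝ) = ε * √ε := by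
    rw [show (3 / 2 : ℝ) = 1 + 1 / 2 by norm_num, Real.rpow_add hε, Real.rpow_one,
      Real.sqrt_eq_rpow]
  -- After multiplication by `η` the three nonnegative terms sum to at most `1/40`. They bound, in
  -- order, the variance error, the square root of the deviation error relative to `ε`, and the step
  -- size.
  have eord : ε * iterationOrder (Fintype.card ι) L β p τ σ ζ ε
      = σ ^ 2 / (Fintype.card ι * ε) + β * √L * T / (p * √ε) + β * L * τ / p := by
    rw [iterationOrder, hpow, ← hT]
    field_simp
  rw [eord, mul_add, mul_add] at hstep
  have n1 : 0 ≤ η * (σ ^ 2 / (Fintype.card ι * ε)) := by positivity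
  have n2 : 0 ≤ η * (β * √L * T / (p * √ε)) := by positivity
  have n3 : 0 ≤ η * (β * L * τ / p) := by positivity
  have key := h.sum_gap_le (x₀ := x₀) hη hpβ (by linarith) K
  rw [← hζe, ← hσe, ← hT] at key
  have b1 : η * σ ^ 2 / Fintype.card ι ≤ ε / 40 := by
    have e : η * σ ^ 2 / Fintype.card ι = η * (σ ^ 2 / (Fintype.card ι * ε)) * ε := by
      field_simp
    rw [e]
    nlinarith
  have b2 : L * (η * β * T / p) ^ 2 ≤ ε / 1600 := by
    have e : L * (η * β * T / p) ^ 2 = (η * (β * √L * T / (p * √ε))) ^ 2 * ε := by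
      rw [← hsε2, Real.sqrt_sq hsε.le]
      nth_rewrite 1 [← hsL2]
      field_simp
    have h2 : (η * (β * √L * T / (p * √ε))) ^ 2 ≤ (1 / 40) ^ 2 :=
      pow_le_pow_left₀ n2 (by linarith) 2
    rw [e]
    nlinarith
  have b3 := hK K (by exact_mod_cast hK1) hKle
  have hηK : 0 < η * K := by positivity
  have hsum : ∑ k ∈ Finset.range K,
      ∫ ω, (globalCost 𝒟 F (avg W F π ξ η x₀ k ω) - globalCost 𝒟 F xs) ∂μ
      = ∑ k ∈ Finset.range K, ∫ ω, globalCost 𝒟 F (avg W F π ξ η x₀ k ω) ∂μ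
        - K * globalCost 𝒟 F xs := by
    have e : ∀ k, ∫ ω, (globalCost 𝒟 F (avg W F π ξ η x₀ k ω) - globalCost 𝒟 F xs) ∂μ
        = ∫ ω, globalCost 𝒟 F (avg W F π ξ η x₀ k ω) ∂μ - globalCost 𝒟 F xs := fun k => by
      rw [integral_sub (h.integrable_globalCost k) (integrable_const _)]
      simp
    simp_rw [e]
    rw [Finset.sum_sub_distrib]
    simp
  rw [hsum] at key
  obtain ⟨S, hS⟩ : ∃ S, S = ∑ k ∈ Finset.range K,
    ∫ ω, globalCost 𝒟 F (avg W F π ξ η x₀ k ω) ∂μ := ⟨_, rfl⟩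
  rw [← hS] at key ⊢
  -- The three contributions are `1/2`, `29/1600` and `3/40` of `ε`, together less than one.
  have c1 : η * (S - K * globalCost 𝒟 F xs) ≤ η * (K * ε) := by
    have := mul_le_mul_of_nonneg_left (add_le_add
      (mul_le_mul_of_nonneg_left b2 (by norm_num : (0 : ℝ) ≤ 29))
      (mul_le_mul_of_nonneg_left b1 (by norm_num : (0 : ℝ) ≤ 3))) hηK.le
    have hpos : 0 < η * K * ε := by positivity
    linarith
  have c2 : S - K * globalCost 𝒟 F xs ≤ K * ε := le_of_mul_le_mul_left c1 hη
  have c3 : 1 / (K : ℝ) * S - globalCost 𝒟 F xs = (S - K * globalCost 𝒟 F xs) / K := by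
    field_simp
  rw [c3, div_le_iff₀ hK0]
  linarith

end Setting

end Summation

end DTGO

end

/-! ### The iteration complexity -/

theorem theorem1 :
    -- an absolute constant
    ∃ C : ℝ, 0 < C ∧
      ∀ (ι κ Ω Ξ : Type*) [Fintype ι] [DecidableEq ι] [Nonempty ι] [Fintype κ] [DecidableEq κ]
        [MeasurableSpace Ω] [MeasurableSpace Ξ] (d : ℕ)
        (μ : Measure Ω) [IsProbabilityMeasure μ]
        (𝒟 : ι → Measure Ξ) [∀ n, IsProbabilityMeasure (𝒟 n)]
        (F : ι → EuclideanSpace ℝ (Fin d) → Ξ → ℝ) (ξ : ℕ → ι → Ω → Ξ)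
        (W : ℕ → Ω → Matrix (ι ⊕ κ) (ι ⊕ κ) ℝ) (π : ι ⊕ κ → ℝ)
        (p : ℝ) (τ : ℕ) (β L : ℝ) (xs x₀ : EuclideanSpace ℝ (Fin d)),
        DTGO.RandomModel μ W 𝒟 ξ →
        DTGO.GossipAssumption μ W π p τ β →
        -- `β` is an upper bound, taken not too small
        p ≤ β * τ →
        0 ≤ L →
        DTGO.ConvexCosts 𝒟 F L xs →
        ∀ ε : ℝ, 0 < ε →
          ∃ η : ℝ, 0 < η ∧
            (∀ k, Integrable (fun ω => DTGO.globalCost 𝒟 F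
              (DTGO.weightedAverage π (DTGO.iterate W F π ξ η x₀ k ω))) μ) ∧
            ∀ K : ℕ, 1 ≤ K →
              C * (DTGO.iterationOrder (Fintype.card ι) L β p τ
                  (DTGO.noiseLevel 𝒟 F xs) (DTGO.heterogeneity 𝒟 F xs) ε
                * ‖DTGO.weightedAverage π (fun _ : ι ⊕ κ => x₀) - xs‖ ^ 2) ≤ K →
              (1 / (K : ℝ)) * ∑ k ∈ Finset.range K,
                  ∫ ω, DTGO.globalCost 𝒟 F
                    (DTGO.weightedAverage π (DTGO.iterate W F π ξ η x₀ k ω)) ∂μ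
                - DTGO.globalCost 𝒟 F xs ≤ ε := by
  refine ⟨100, by norm_num, ?_⟩
  intro ι κ Ω Ξ _ _ _ _ _ _ _ d μ _ 𝒟 _ F ξ W π p τ β L xs x₀ hR hG hpβ hL hC ε hε
  have h : DTGO.Setting μ 𝒟 F ξ W π p τ β L xs := ⟨hR, hG, hC, hL⟩
  obtain ⟨η, hη, hK⟩ := h.exists_stepSize_average_gap_le (x₀ := x₀) hpβ hε
  exact ⟨η, hη, h.integrable_globalCost, hK⟩
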